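/- Let $\mathbb T^n=\mathbb R^n/\mathbb Z^n$ with projection $p:\mathbb R^n\to\mathbb T^n$, and for $A\in \mathrm{SL}(n,\mathbb Z)$ write $A$ also for the induced automorphism of $\mathbb T^n$. A $C^\infty$ diffeomorphism $f$ of $\mathbb T^n$ is \emph{partially hyperbolic} if there are a $Df$-invariant continuous splitting $T\mathbb T^n=E^{ss}_f\oplus E^c_f\oplus E^{uu}_f$ into three nonzero subbundles, a Riemannian metric, and numbers $\lambda_s<1<\lambda_u$, $\lambda_s<\lambda_c^-<\lambda_c^+<\lambda_u$ such that for every $x$ and every nonzero $v\in T_x\mathbb T^n$: $\|Df_xv\|<\lambda_s\|v\|$ if $v\in E^{ss}_f(x)$; $\lambda_c^-\|v\|<\|Df_xv\|<\lambda_c^+\|v\|$ if $v\in E^{c}_f(x)$; and $\lambda_u\|v\|<\|Df_xv\|$ if $v\in E^{uu}_f(x)$. If $A$ is partially hyperbolic with a linear splitting $\mathbb R^n=E^{ss}_A\oplus E^c_A\oplus E^{uu}_A$, let $\mathcal{PH}_A(\mathbb T^n)$ be the set of partially hyperbolic diffeomorphisms $f$ of $\mathbb T^n$ that are (smoothly)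 isotopic to $A$ and satisfy $\dim E^*_f=\dim E^*_A$ for $*=ss,c,uu$. A bijection $f$ of $\mathbb T^n$ is \emph{expansive} if there is $\delta>0$ such that $d(f^k(x),f^k(y))\le\delta$ for all $k\in\mathbb Z$ implies $x=y$. (1) Let $A\in\mathrm{SL}(n,\mathbb Z)$ be symmetric and partially hyperbolic with a linear splitting $\mathbb R^n=E^{ss}_A\oplus E^c_A\oplus E^{uu}_A$, where $\dim E^c_A=k$ and $E^c_A$ has a basis of eigenvectors of $A$ with eigenvalues $0<\lambda_1\le\dots\le\lambda_k<1$. Then for every $\varepsilon>0$ there is $f\in\mathcal{PH}_A(\mathbb T^n)$ such that $f(x)=Ax$ for every $x\notin p(B(0,\varepsilon))$, $f$ is expansive, $f(0)=0$ and $Df_0|_{E^c_f(0)}=\mathrm{Id}$. (2) Let $A\in\mathrm{SL}(4,\mathbb Z)$ have four eigenvalues $0<\lambda^{ss}<\lambda<1<\mu<\mu^{uu}$, and let $E^{ss}_A$, $E^c_A$, $E^{uu}_A$ be, respectively, the eigenspace of $\lambda^{ss}$, the sum of the eigenspaces of $\lambda$ and $\mu$, and the eigenspace of $\mu^{uu}$.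 Then for every $\varepsilon>0$ there is $f\in\mathcal{PH}_A(\mathbb T^4)$, with $\dim E^c_f=2$, such that $f(x)=Ax$ for every $x\notin p(B(0,\varepsilon))$, $f$ is expansive, $f(0)=0$ and $Df_0|_{E^c_f(0)}=\mathrm{Id}$. -/

import Mathlib

open scoped ContDiff

namespace ToralPH

noncomputable section

/-- The Euclidean space `ℝⁿ`. -/
abbrev E (n : ℕ) := EuclideanSpace ℝ (Fin n)

/-- The torus `𝕋ⁿ = ℝⁿ / ℤⁿ`, as a product of `n` circles `ℝ / ℤ`. -/
abbrev Torus (n : ℕ) := UnitAddTorus (Fin n)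

/-- The canonical projection `ℝⁿ → 𝕋ⁿ`. -/
def proj {n : ℕ} (x : E n) : Torus n := fun i => ((x i : ℝ) : UnitAddCircle)

theorem proj_surjective {n : ℕ} : Function.Surjective (proj (n := n)) := by
  intro y
  choose x hx using fun i => QuotientAddGroup.mk_surjective (y i)
  exact ⟨WithLp.toLp 2 x, funext fun i => hx i⟩

/-! ### Smooth maps of the torus and their derivatives

The tangent bundle of `𝕋ⁿ` is `𝕋ⁿ × ℝⁿ`; a self-map of `𝕋ⁿ` is smooth exactly when it has a smooth
lift to `ℝⁿ`, and its derivative is the derivative of any such lift. -/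

/-- `F` is a `C^∞` lift of `f` to `ℝⁿ`. -/
def IsSmoothLift {n : ℕ} (F : E n → E n) (f : Torus n → Torus n) : Prop :=
  ContDiff ℝ ∞ F ∧ ∀ x, proj (F x) = f (proj x)

/-- `f : 𝕋ⁿ → 𝕋ⁿ` is `C^∞`. -/
def IsSmooth {n : ℕ} (f : Torus n → Torus n) : Prop := ∃ F, IsSmoothLift F f

open Classical in
/-- The derivative `Df_x : T_x 𝕋ⁿ = ℝⁿ → ℝⁿ = T_{f x} 𝕋ⁿ` of a smooth map `f` (see
`torusDeriv_proj` for its independence of the choice of the lift and of the point above `x`). -/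
def torusDeriv {n : ℕ} (f : Torus n → Torus n) (x : Torus n) : E n →L[ℝ] E n :=
  if h : IsSmooth f then fderiv ℝ h.choose (Function.surjInv proj_surjective x) else 0

theorem exists_const_of_proj_eq {n : ℕ} {F G : E n → E n} (hF : Continuous F) (hG : Continuous G)
    (h : ∀ x, proj (F x) = proj (G x)) : ∃ c : E n, ∀ x, F x = G x + c := by
  refine ⟨F 0 - G 0, fun x => ?_⟩
  ext i
  have hint : ∀ y, ∃ m : ℤ, F y i - G y i = (m : ℝ) := fun y => by
    have h1 := congrFun (h y) i
    simp only [proj] at h1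
    rw [eq_comm, QuotientAddGroup.eq_iff_sub_mem, ← neg_mem_iff, neg_sub,
      AddSubgroup.mem_zmultiples_iff] at h1
    obtain ⟨m, hm⟩ := h1
    exact ⟨m, by simpa using hm.symm⟩
  choose m hm using hint
  have hcont : Continuous m := by
    rw [Int.isClosedEmbedding_coe_real.isInducing.continuous_iff]
    have : ((↑) : ℤ → ℝ) ∘ m = fun y => F y i - G y i := funext fun y => (hm y).symm
    rw [this]
    fun_prop
  have := PreconnectedSpace.constant (inferInstance : PreconnectedSpace (E n)) hcont (x := x) (y := 0)
  have h1 := hm x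
  have h0 := hm 0
  rw [this, ← h0] at h1
  simp only [PiLp.add_apply, PiLp.sub_apply]
  linarith

theorem proj_add {n : ℕ} (x y : E n) : proj (x + y) = proj x + proj y := by
  funext i
  simp [proj]

theorem torusDeriv_proj {n : ℕ} {f : Torus n → Torus n} {F : E n → E n} (hF : IsSmoothLift F f)
    (x : E n) : torusDeriv f (proj x) = fderiv ℝ F x := by
  have hs : IsSmooth f := ⟨F, hF⟩
  set y := Function.surjInv proj_surjective (proj x) with hy
  have hyx : proj y = proj x := Function.surjInv_eq proj_surjective _
  have hG := hs.choose_spec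
  rw [torusDeriv, dif_pos hs]
  have hshift : ∀ z, proj (z + (y - x)) = proj z := fun z => by
    have : proj y = proj x + proj (y - x) := by rw [← proj_add]; congr 1; abel
    have h0 : proj (y - x) = 0 := by
      rw [hyx] at this
      exact left_eq_add.mp this
    rw [proj_add, h0, add_zero]
  obtain ⟨c, hc⟩ := exists_const_of_proj_eq (F := fun z => hs.choose (z + (y - x))) (G := F)
    (hG.1.continuous.comp (by fun_prop)) hF.1.continuous
    (fun z => by rw [hG.2, hF.2, hshift])
  have h1 : fderiv ℝ (fun z => hs.choose (z + (y - x))) x = fderiv ℝ F x := by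
    rw [funext hc, fderiv_add_const]
  rw [fderiv_comp_add_right] at h1
  simpa using h1

/-- `f` is a `C^∞` diffeomorphism of the torus. -/
def IsDiffeo {n : ℕ} (f : Equiv.Perm (Torus n)) : Prop := IsSmooth f ∧ IsSmooth f.symm

/-! ### Linear automorphisms -/

/-- The linear map of `ℝⁿ` given by an integer matrix. -/
def linMap {n : ℕ} (A : Matrix.SpecialLinearGroup (Fin n) ℤ) : E n →ₗ[ℝ] E n :=
  Matrix.toEuclideanLin (A.1.map (Int.cast : ℤ → ℝ))

/-- The map `f_A` of the torus induced by an integer matrix. -/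
def toralMap {n : ℕ} (M : Matrix (Fin n) (Fin n) ℤ) (x : Torus n) : Torus n :=
  fun i => ∑ j, M i j • x j

theorem toralMap_mul {n : ℕ} (M N : Matrix (Fin n) (Fin n) ℤ) (x : Torus n) :
    toralMap M (toralMap N x) = toralMap (M * N) x := by
  funext i
  simp only [toralMap, Matrix.mul_apply, Finset.sum_smul, Finset.smul_sum, mul_smul]
  exact Finset.sum_comm

theorem toralMap_one {n : ℕ} (x : Torus n) : toralMap 1 x = x := by
  funext i
  simp [toralMap, Matrix.one_apply, ite_smul]

/-- The automorphism `f_A` of the torus induced by `A ∈ SL(n, ℤ)`. -/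
def toralAut {n : ℕ} (A : Matrix.SpecialLinearGroup (Fin n) ℤ) : Equiv.Perm (Torus n) where
  toFun := toralMap A.1
  invFun := toralMap (A⁻¹).1
  left_inv x := by
    rw [toralMap_mul, ← Matrix.SpecialLinearGroup.coe_mul, inv_mul_cancel,
      Matrix.SpecialLinearGroup.coe_one, toralMap_one]
  right_inv x := by
    rw [toralMap_mul, ← Matrix.SpecialLinearGroup.coe_mul, mul_inv_cancel,
      Matrix.SpecialLinearGroup.coe_one, toralMap_one]

/-- `f_A ∘ p = p ∘ A`. -/
theorem proj_linMap {n : ℕ} (A : Matrix.SpecialLinearGroup (Fin n) ℤ) (x : E n) :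
    proj (linMap A x) = toralAut A (proj x) := by
  funext i
  change ((linMap A x i : ℝ) : UnitAddCircle) = ∑ j, A.1 i j • ((x j : ℝ) : UnitAddCircle)
  have : linMap A x i = ∑ j, A.1 i j • x j := by
    simp [linMap, Matrix.mulVec, dotProduct]
  rw [this]
  have h := map_sum (QuotientAddGroup.mk' (AddSubgroup.zmultiples (1 : ℝ)))
    (fun j => A.1 i j • x j) Finset.univ
  simp only [map_zsmul] at h
  exact h

/-! ### Partial hyperbolicity -/

/-- A smooth Riemannian metric on the torus. -/
structure RiemMetric (n : ℕ) where
  /-- The inner product on `T_x 𝕋ⁿ = ℝⁿ`. -/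
  inner : Torus n → E n →L[ℝ] E n →L[ℝ] ℝ
  symm : ∀ x v w, inner x v w = inner x w v
  pos : ∀ x v, v ≠ 0 → 0 < inner x v v
  smooth : ContDiff ℝ ∞ fun x : E n => inner (proj x)

/-- The length of the tangent vector `v ∈ T_x 𝕋ⁿ`. -/
def RiemMetric.norm {n : ℕ} (g : RiemMetric n) (x : Torus n) (v : E n) : ℝ :=
  Real.sqrt (g.inner x v v)

/-- A continuous subbundle of `T𝕋ⁿ = 𝕋ⁿ × ℝⁿ`: a field of subspaces of constant dimension whose
total space is closed (for constant dimension this is continuity into the Grassmannian). -/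
def IsSubbundle {n : ℕ} (V : Torus n → Submodule ℝ (E n)) : Prop :=
  (∃ d : ℕ, ∀ x, Module.finrank ℝ (V x) = d) ∧ IsClosed {q : Torus n × E n | q.2 ∈ V q.1}

/-- The diffeomorphism `f` of the torus is partially hyperbolic with splitting
`T𝕋ⁿ = Ess ⊕ Ec ⊕ Euu`. -/
structure IsPartiallyHyperbolic {n : ℕ} (f : Equiv.Perm (Torus n))
    (Ess Ec Euu : Torus n → Submodule ℝ (E n)) : Prop where
  diffeo : IsDiffeo f
  subbundle_ss : IsSubbundle Ess
  subbundle_c : IsSubbundle Ec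
  subbundle_uu : IsSubbundle Euu
  nontrivial : ∀ x, Ess x ≠ ⊥ ∧ Ec x ≠ ⊥ ∧ Euu x ≠ ⊥
  splitting : ∀ x, DirectSum.IsInternal ![Ess x, Ec x, Euu x]
  invariant_ss : ∀ x, (Ess x).map (torusDeriv f x : E n →ₗ[ℝ] E n) = Ess (f x)
  invariant_c : ∀ x, (Ec x).map (torusDeriv f x : E n →ₗ[ℝ] E n) = Ec (f x)
  invariant_uu : ∀ x, (Euu x).map (torusDeriv f x : E n →ₗ[ℝ] E n) = Euu (f x)
  rates : ∃ (g : RiemMetric n) (ls lc lc' lu : ℝ), ls < 1 ∧ 1 < lu ∧ ls < lc ∧ lc < lc' ∧ lc' < lu ∧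
    ∀ x v, v ≠ 0 →
      (v ∈ Ess x → g.norm (f x) (torusDeriv f x v) < ls * g.norm x v) ∧
      (v ∈ Ec x → lc * g.norm x v < g.norm (f x) (torusDeriv f x v) ∧
        g.norm (f x) (torusDeriv f x v) < lc' * g.norm x v) ∧
      (v ∈ Euu x → lu * g.norm x v < g.norm (f x) (torusDeriv f x v))

/-- `f` and `g` are smoothly isotopic: they are joined by a smooth path of diffeomorphisms. -/
def Isotopic {n : ℕ} (f g : Equiv.Perm (Torus n)) : Prop :=
  ∃ (H : ℝ → Equiv.Perm (Torus n)) (Φ : ℝ × E n → E n),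
    H 0 = f ∧ H 1 = g ∧ (∀ t ∈ Set.Icc (0 : ℝ) 1, IsDiffeo (H t)) ∧
    ContDiffOn ℝ ∞ Φ (Set.Icc (0 : ℝ) 1 ×ˢ Set.univ) ∧
    ∀ t ∈ Set.Icc (0 : ℝ) 1, ∀ x, proj (Φ (t, x)) = H t (proj x)

/-- `f ∈ PH_A(𝕋ⁿ)`, with splitting `Ess ⊕ Ec ⊕ Euu`, where `A` has the linear splitting
`ℝⁿ = Sss ⊕ Sc ⊕ Suu`: `f` is partially hyperbolic, isotopic to `f_A`, and the dimensions of the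
bundles are those of `A`. -/
structure MemPH {n : ℕ} (A : Matrix.SpecialLinearGroup (Fin n) ℤ) (Sss Sc Suu : Submodule ℝ (E n))
    (f : Equiv.Perm (Torus n)) (Ess Ec Euu : Torus n → Submodule ℝ (E n)) : Prop where
  partiallyHyperbolic : IsPartiallyHyperbolic f Ess Ec Euu
  isotopic : Isotopic f (toralAut A)
  dim_ss : ∀ x, Module.finrank ℝ (Ess x) = Module.finrank ℝ Sss
  dim_c : ∀ x, Module.finrank ℝ (Ec x) = Module.finrank ℝ Sc
  dim_uu : ∀ x, Module.finrank ℝ (Euu x) = Module.finrank ℝ Suu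

/-- Expansivity: distinct points are separated by a uniform distance at some time in `ℤ`. -/
def IsExpansive {X : Type*} [MetricSpace X] (f : Equiv.Perm X) : Prop :=
  ∃ δ > 0, ∀ x y, (∀ k : ℤ, dist ((f ^ k) x) ((f ^ k) y) ≤ δ) → x = y

end

end ToralPH

namespace ToralPH

noncomputable section

/-! ### A slowly varying cutoff and its radial vector field -/

/-! In eigencoordinates `A` is diagonal with entries `ν i`. Near each lattice point, subtract the
field with components `ψ(‖z‖²) (ν i - 1) z i`, in the central coordinates only. Since `ψ 0 = 1`, the
derivative at `0` becomes the identity on the centre, and nothing changes away from the lattice.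

Partial hyperbolicity. Up to an error controlled by `|t ψ'(t)|`, the new derivative acts on the
centre diagonally with entries `(1 - ψ) ν i + ψ`, which lie between `ν i` and `1` and hence in the
central range. A cutoff that varies slowly on the logarithmic scale keeps the error within a quarter
of the spectral gap, however small its support (`exists_isProfile`, `norm_locDeriv_sub_le`).
Monotonicity on the centre and properness make the map a diffeomorphism. Only central coordinates
are perturbed, so the linear centre stays invariant. The strong bundles are graphs over the linear
ones with values in the centre, found as fixed points of contracting graph transforms
(`exists_stable_graph`, `exists_unstable_graph`). Shrinking the central coordinates flattens these
graphs, so one constant metric exhibits all the rates (`exists_rates`).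

Expansivity. If two orbits stay close, the noncentral coordinates of their difference are multiplied
by `ν i` with `|ν i| ≠ 1`, so they vanish. A central difference `w` is sent to `w + δ g`, where `δ i
= ν i - 1` and `g` is the difference of the values of `z - ψ(‖z‖²) z`. The form `∑ w i² / δ i` then
changes by `2⟨g, w⟩ + ∑ δ i (g i)²`. Cocoercivity gives `‖g‖² ≤ 2⟨g, w⟩`, and `δ i ≥ β - 1`, so the
form grows by at least `2β⟨g, w⟩`, which is positive for `w ≠ 0` because `ψ < 1` off `0`
(`quad_map_sub_ge`). A bounded two-sided orbit cannot sustain such growth unless it is zero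
(`eq_zero_of_lyapunov`). The `δ i` may have either sign, so contracting and mixed centres are
treated together. -/

/-- A smooth profile which equals `1` only at `0`, decreases to `0` before `ρ`, and varies slowly on
the logarithmic scale. -/
structure IsProfile (ψ : ℝ → ℝ) (η ρ : ℝ) : Prop where
  smooth : ContDiff ℝ ∞ ψ
  zero : ψ 0 = 1
  nonneg : ∀ t, 0 ≤ ψ t
  lt_one : ∀ t, t ≠ 0 → ψ t < 1
  eq_zero : ∀ t, ρ ≤ t → ψ t = 0
  antitone : AntitoneOn ψ (Set.Ici 0)
  deriv_le : ∀ t, |t * deriv ψ t| ≤ η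

theorem exists_bound_deriv_smoothTransition :
    ∃ K : ℝ, 0 < K ∧ ∀ x, |deriv Real.smoothTransition x| ≤ K := by
  have hc : Continuous (deriv Real.smoothTransition) :=
    (Real.smoothTransition.contDiff (n := 1)).continuous_deriv le_rfl
  obtain ⟨K, hK⟩ := (isCompact_Icc (a := (-1 : ℝ)) (b := 2)).exists_bound_of_continuousOn
    hc.continuousOn
  refine ⟨max K 1, by positivity, fun x => ?_⟩
  by_cases hx : x ∈ Set.Icc (-1 : ℝ) 2
  · exact (hK x hx).trans (le_max_left _ _)
  · have : deriv Real.smoothTransition x = 0 := by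
      rw [Set.mem_Icc, not_and_or, not_le, not_le] at hx
      rcases hx with hx | hx
      · have : Real.smoothTransition =ᶠ[nhds x] fun _ => 0 := by
          filter_upwards [Iio_mem_nhds hx] with y hy
          exact Real.smoothTransition.zero_of_nonpos (by simp at hy; linarith)
        rw [this.deriv_eq, deriv_const]
      · have : Real.smoothTransition =ᶠ[nhds x] fun _ => 1 := by
          filter_upwards [Ioi_mem_nhds hx] with y hy
          exact Real.smoothTransition.one_of_one_le (by simp at hy; linarith)
        rw [this.deriv_eq, deriv_const]
    rw [this]
    simp

/-- The logarithmic derivative `t (log (1 + c t²))'` is at most `2` whatever `c` is. Hence `κ` alone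
controls the slope `η`, and `c` remains free to make the support as small as required. -/
theorem exists_isProfile {η ρ : ℝ} (hη : 0 < η) (hρ : 0 < ρ) : ∃ ψ, IsProfile ψ η ρ := by
  obtain ⟨K, hK, hKb⟩ := exists_bound_deriv_smoothTransition
  -- Chosen so that the final bound `K * (2 * κ)` equals `η`.
  set κ : ℝ := η / (2 * K) with hκ
  have hκ0 : 0 < κ := by positivity
  -- the scale at which the logarithm reaches `1 / κ` at `ρ`
  set c : ℝ := (Real.exp (1 / κ) - 1) / ρ ^ 2 with hc
  have hc0 : 0 < c := by
    have : 1 < Real.exp (1 / κ) := Real.one_lt_exp_iff.2 (by positivity)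
    have : 0 < Real.exp (1 / κ) - 1 := by linarith
    positivity
  have hpos : ∀ t : ℝ, 0 < 1 + c * t ^ 2 := fun t => by positivity
  have hd : ∀ t : ℝ, HasDerivAt (fun t : ℝ => 1 - κ * Real.log (1 + c * t ^ 2))
      (-(κ * ((c * (2 * t)) / (1 + c * t ^ 2)))) t := fun t => by
    have h1 : HasDerivAt (fun t : ℝ => 1 + c * t ^ 2) (c * (2 * t)) t := by
      simpa using ((hasDerivAt_pow 2 t).const_mul c).const_add 1
    simpa using ((h1.log (hpos t).ne').const_mul κ).const_sub 1
  refine ⟨fun t => Real.smoothTransition (1 - κ * Real.log (1 + c * t ^ 2)), ?_, ?_, ?_, ?_, ?_,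
    ?_, ?_⟩
  · refine Real.smoothTransition.contDiff.comp (contDiff_const.sub (contDiff_const.mul ?_))
    exact ContDiff.log (by fun_prop) fun t => (hpos t).ne'
  · simp
  · exact fun t => Real.smoothTransition.nonneg _
  · intro t ht
    refine Real.smoothTransition.lt_one_of_lt_one ?_
    have : 0 < Real.log (1 + c * t ^ 2) := Real.log_pos (by
      have : 0 < t ^ 2 := by positivity
      nlinarith)
    nlinarith
  · intro t ht
    refine Real.smoothTransition.zero_of_nonpos ?_
    have h1 : 1 / κ ≤ Real.log (1 + c * t ^ 2) := by
      rw [Real.le_log_iff_exp_le (hpos t)]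
      have : c * ρ ^ 2 = Real.exp (1 / κ) - 1 := by rw [hc]; field_simp
      have h2 : ρ ^ 2 ≤ t ^ 2 := by gcongr
      nlinarith
    have : κ * (1 / κ) = 1 := by field_simp
    nlinarith
  · intro s hs t ht hst
    refine Real.smoothTransition.monotone ?_
    have hs' : (0 : ℝ) ≤ s := hs
    have : Real.log (1 + c * s ^ 2) ≤ Real.log (1 + c * t ^ 2) :=
      Real.log_le_log (hpos s) (by gcongr)
    nlinarith
  · intro t
    have h1 : HasDerivAt (fun t => Real.smoothTransition (1 - κ * Real.log (1 + c * t ^ 2)))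
        (deriv Real.smoothTransition (1 - κ * Real.log (1 + c * t ^ 2)) *
          (-(κ * ((c * (2 * t)) / (1 + c * t ^ 2))))) t :=
      ((Real.smoothTransition.contDiff (n := 1)).differentiable one_ne_zero
        _).hasDerivAt.comp t (hd t)
    rw [h1.deriv]
    have h2 : t * (deriv Real.smoothTransition (1 - κ * Real.log (1 + c * t ^ 2)) *
          (-(κ * ((c * (2 * t)) / (1 + c * t ^ 2))))) =
        -(deriv Real.smoothTransition (1 - κ * Real.log (1 + c * t ^ 2)) * (2 * κ)) *
          (c * t ^ 2 / (1 + c * t ^ 2)) := by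
      ring
    have h3 : c * t ^ 2 / (1 + c * t ^ 2) ≤ 1 := by
      rw [div_le_one (hpos t)]; linarith
    have h4 : 0 ≤ c * t ^ 2 / (1 + c * t ^ 2) := by have := hpos t; positivity
    rw [h2, abs_mul, abs_neg, abs_mul, abs_of_nonneg h4, abs_of_pos (by positivity : 0 < 2 * κ)]
    calc _ ≤ K * (2 * κ) * 1 := by gcongr; exact hKb _
      _ = η := by rw [hκ]; field_simp

theorem IsProfile.le_one {ψ : ℝ → ℝ} {η ρ : ℝ} (h : IsProfile ψ η ρ) (t : ℝ) : ψ t ≤ 1 := by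
  rcases eq_or_ne t 0 with rfl | ht
  · exact h.zero.le
  · exact (h.lt_one t ht).le

section Radial

variable {X : Type*} [NormedAddCommGroup X] [InnerProductSpace ℝ X]

/-- The radial vector field `ψ(‖z‖²) z`. -/
def radial (ψ : ℝ → ℝ) (z : X) : X := ψ (‖z‖ ^ 2) • z

/-- The derivative of `radial ψ` at `z`. -/
def radialDeriv (ψ : ℝ → ℝ) (z : X) : X →L[ℝ] X :=
  ψ (‖z‖ ^ 2) • ContinuousLinearMap.id ℝ X +
    (2 * deriv ψ (‖z‖ ^ 2)) • (innerSL ℝ z).smulRight z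

theorem radialDeriv_apply (ψ : ℝ → ℝ) (z v : X) :
    radialDeriv ψ z v = ψ (‖z‖ ^ 2) • v + (2 * deriv ψ (‖z‖ ^ 2) * inner ℝ z v) • z := by
  simp [radialDeriv, smul_smul]

theorem contDiff_radial {ψ : ℝ → ℝ} (hψ : ContDiff ℝ ∞ ψ) : ContDiff ℝ ∞ (radial (X := X) ψ) :=
  (hψ.comp (contDiff_norm_sq ℝ)).smul contDiff_id

theorem hasFDerivAt_radial {ψ : ℝ → ℝ} (hψ : ContDiff ℝ ∞ ψ) (z : X) :
    HasFDerivAt (radial ψ) (radialDeriv ψ z) z := by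
  have h1 : HasFDerivAt (fun z : X => ‖z‖ ^ 2) (2 • innerSL ℝ z) z :=
    (hasStrictFDerivAt_norm_sq z).hasFDerivAt
  have h2 : HasDerivAt ψ (deriv ψ (‖z‖ ^ 2)) (‖z‖ ^ 2) :=
    (hψ.differentiable (by simp) _).hasDerivAt
  have h3 := (h2.comp_hasFDerivAt z h1).smul (hasFDerivAt_id z)
  refine h3.congr_fderiv ?_
  ext v
  simp [radialDeriv_apply]
  ring_nf

/-- The radial derivative is `ψ` times the identity, up to a small error. -/
theorem norm_radialDeriv_sub_le {ψ : ℝ → ℝ} {η ρ : ℝ} (hψ : IsProfile ψ η ρ) (z v : X) :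
    ‖radialDeriv ψ z v - ψ (‖z‖ ^ 2) • v‖ ≤ 2 * η * ‖v‖ := by
  rw [radialDeriv_apply, add_sub_cancel_left, norm_smul, Real.norm_eq_abs, abs_mul, abs_mul]
  have h1 : |inner ℝ z v| ≤ ‖z‖ * ‖v‖ := abs_real_inner_le_norm z v
  -- The rank-one term carries the factor `‖z‖²`, which is exactly the `t` of the bound on `t
  -- ψ'(t)`.
  have h2 := hψ.deriv_le (‖z‖ ^ 2)
  rw [abs_mul, abs_of_nonneg (sq_nonneg ‖z‖)] at h2
  calc |2| * |deriv ψ (‖z‖ ^ 2)| * |inner ℝ z v| * ‖z‖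
      ≤ |2| * |deriv ψ (‖z‖ ^ 2)| * (‖z‖ * ‖v‖) * ‖z‖ := by gcongr
    _ = 2 * (‖z‖ ^ 2 * |deriv ψ (‖z‖ ^ 2)|) * ‖v‖ := by rw [abs_two]; ring
    _ ≤ 2 * η * ‖v‖ := by gcongr

theorem radial_eq_zero {ψ : ℝ → ℝ} {η r : ℝ} (hψ : IsProfile ψ η (r ^ 2)) (hr : 0 ≤ r) {z : X}
    (hz : r ≤ ‖z‖) : radial ψ z = 0 := by
  rw [radial, hψ.eq_zero _ (by gcongr), zero_smul]

theorem norm_radial_le {ψ : ℝ → ℝ} {η r : ℝ} (hψ : IsProfile ψ η (r ^ 2)) (hr : 0 ≤ r) (z : X) :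
    ‖radial ψ z‖ ≤ r := by
  by_cases hz : r ≤ ‖z‖
  · rw [radial_eq_zero hψ hr hz]; simpa
  · rw [radial, norm_smul, Real.norm_eq_abs, abs_of_nonneg (hψ.nonneg _)]
    have := hψ.le_one (‖z‖ ^ 2)
    have h2 := norm_nonneg z
    nlinarith [hψ.nonneg (‖z‖ ^ 2)]

/-- The scalar profile of the complementary field `z - radial ψ z` is `2`-Lipschitz and monotone. -/
theorem complement_profile_bounds {ψ : ℝ → ℝ} {η ρ : ℝ} (hψ : IsProfile ψ η ρ) (hη : 2 * η ≤ 1)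
    {p q : ℝ} (hq : 0 ≤ q) (hqp : q ≤ p) :
    0 ≤ (1 - ψ (p ^ 2)) * p - (1 - ψ (q ^ 2)) * q ∧
      (1 - ψ (p ^ 2)) * p - (1 - ψ (q ^ 2)) * q ≤ 2 * (p - q) := by
  constructor
  · have h1 : ψ (p ^ 2) ≤ ψ (q ^ 2) :=
      hψ.antitone (sq_nonneg q : (0:ℝ) ≤ q ^ 2) (sq_nonneg p : (0:ℝ) ≤ p ^ 2) (by gcongr)
    have := hψ.le_one (p ^ 2)
    nlinarith
  · have hd : ∀ t : ℝ, HasDerivAt (fun t => (1 - ψ (t ^ 2)) * t)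
        (-(deriv ψ (t ^ 2) * (2 * t)) * t + (1 - ψ (t ^ 2))) t := fun t => by
      have h1 : HasDerivAt (fun t : ℝ => ψ (t ^ 2)) (deriv ψ (t ^ 2) * (2 * t)) t :=
        (hψ.smooth.differentiable (by simp) _).hasDerivAt.comp t (by simpa using hasDerivAt_pow 2 t)
      simpa using (h1.const_sub 1).fun_mul (hasDerivAt_id' t)
    have := Convex.image_sub_le_mul_sub_of_deriv_le (convex_univ (𝕜 := ℝ) (E := ℝ))
      (f := fun t => (1 - ψ (t ^ 2)) * t) (C := 2)
      (fun t _ => (hd t).continuousAt.continuousWithinAt)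
      (fun t _ => (hd t).differentiableAt.differentiableWithinAt)
      (fun t _ => by
        rw [(hd t).deriv]
        -- The derivative is `1 - ψ(t²) - 2 t² ψ'(t²)`, at most `1 + 2η ≤ 2`.
        have h1 := (abs_le.1 (hψ.deriv_le (t ^ 2))).1
        have h2 := hψ.nonneg (t ^ 2)
        nlinarith) q (Set.mem_univ _) p (Set.mem_univ _) hqp
    exact this

/-- Cocoercivity of the field `z ↦ z - radial ψ z`. -/
theorem norm_sq_complement_sub_le {ψ : ℝ → ℝ} {η ρ : ℝ} (hψ : IsProfile ψ η ρ) (hη : 2 * η ≤ 1)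
    (x y : X) :
    ‖(x - y) - (radial ψ x - radial ψ y)‖ ^ 2 ≤
      2 * inner ℝ ((x - y) - (radial ψ x - radial ψ y)) (x - y) := by
  wlog hxy : ‖y‖ ≤ ‖x‖ generalizing x y
  · have := this y x (le_of_not_ge hxy)
    have e1 : (x - y) - (radial ψ x - radial ψ y) = -((y - x) - (radial ψ y - radial ψ x)) := by
      abel
    have e2 : x - y = -(y - x) := by abel
    rwa [e1, norm_neg, e2, inner_neg_neg]
  obtain ⟨h1, h2⟩ := complement_profile_bounds hψ hη (norm_nonneg y) hxy
  set a := 1 - ψ (‖x‖ ^ 2) with ha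
  set b := 1 - ψ (‖y‖ ^ 2) with hb
  have ha0 : 0 ≤ a := by have := hψ.le_one (‖x‖ ^ 2); linarith
  have hb0 : 0 ≤ b := by have := hψ.le_one (‖y‖ ^ 2); linarith
  have ha1 : a ≤ 1 := by have := hψ.nonneg (‖x‖ ^ 2); linarith
  have hb1 : b ≤ 1 := by have := hψ.nonneg (‖y‖ ^ 2); linarith
  have e : (x - y) - (radial ψ x - radial ψ y) = a • x - b • y := by
    simp only [radial, ha, hb, sub_smul, one_smul]; abel
  rw [e, norm_sub_sq_real, inner_sub_left, inner_sub_right, inner_sub_right]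
  simp only [norm_smul, real_inner_smul_left, real_inner_smul_right, real_inner_self_eq_norm_sq,
    Real.norm_eq_abs, abs_of_nonneg ha0, abs_of_nonneg hb0, real_inner_comm x y]
  have ht := abs_le.1 (abs_real_inner_le_norm x y)
  set t := inner ℝ x y
  set p := ‖x‖
  set q := ‖y‖
  have hp : 0 ≤ p := norm_nonneg x
  have hq : 0 ≤ q := norm_nonneg y
  -- the difference of the two sides is affine in `t` and nonnegative at `t = ± p q`
  have E1 : 0 ≤ (2 * (p - q) - (a * p - b * q)) * (a * p - b * q) :=
    mul_nonneg (by linarith) h1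
  have E2 : 0 ≤ (2 * (p + q) - (a * p + b * q)) * (a * p + b * q) := by
    refine mul_nonneg ?_ (by positivity)
    nlinarith
  rcases le_total 0 (2 * a * b - 2 * (a + b)) with hs | hs
  · nlinarith [mul_nonneg hs (by linarith : 0 ≤ t + p * q)]
  · nlinarith [mul_nonneg (neg_nonneg.2 hs) (by linarith : 0 ≤ p * q - t)]

/-- Quantitative strict monotonicity of the field `z ↦ z - radial ψ z`. -/
theorem inner_complement_sub_ge {ψ : ℝ → ℝ} {η ρ : ℝ} (hψ : IsProfile ψ η ρ) (x y : X) :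
    (1 - ψ ((‖x - y‖ / 2) ^ 2)) / 2 * ‖x - y‖ ^ 2 ≤
      inner ℝ ((x - y) - (radial ψ x - radial ψ y)) (x - y) := by
  wlog hxy : ‖y‖ ≤ ‖x‖ generalizing x y
  · have := this y x (le_of_not_ge hxy)
    have e1 : (x - y) - (radial ψ x - radial ψ y) = -((y - x) - (radial ψ y - radial ψ x)) := by
      abel
    have e2 : x - y = -(y - x) := by abel
    rwa [e1, e2, inner_neg_neg, norm_neg]
  have hanti : ψ (‖x‖ ^ 2) ≤ ψ (‖y‖ ^ 2) :=
    hψ.antitone (sq_nonneg _ : (0:ℝ) ≤ _) (sq_nonneg _ : (0:ℝ) ≤ _) (by gcongr)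
  -- The longer of the two vectors has at least half the length of the difference, so its profile
  -- value is bounded in terms of the difference alone.
  have hw : ‖x - y‖ / 2 ≤ ‖x‖ := by have := norm_sub_le x y; linarith
  have hanti' : ψ (‖x‖ ^ 2) ≤ ψ ((‖x - y‖ / 2) ^ 2) :=
    hψ.antitone (sq_nonneg _ : (0:ℝ) ≤ _) (sq_nonneg _ : (0:ℝ) ≤ _) (by gcongr)
  have hone := hψ.le_one (‖y‖ ^ 2)
  -- Symmetrising in the two coefficients leaves a cross term, which is nonnegative because `1 - ψ`
  -- increases with the norm.
  have e : inner ℝ ((x - y) - (radial ψ x - radial ψ y)) (x - y) =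
      (1 - ψ (‖x‖ ^ 2) + (1 - ψ (‖y‖ ^ 2))) / 2 * ‖x - y‖ ^ 2 +
        (ψ (‖y‖ ^ 2) - ψ (‖x‖ ^ 2)) / 2 * (‖x‖ ^ 2 - ‖y‖ ^ 2) := by
    rw [norm_sub_sq_real]
    simp only [radial, inner_sub_left, inner_sub_right, real_inner_smul_left,
      real_inner_self_eq_norm_sq, real_inner_comm x y]
    ring
  rw [e]
  have h1 : 0 ≤ (ψ (‖y‖ ^ 2) - ψ (‖x‖ ^ 2)) / 2 * (‖x‖ ^ 2 - ‖y‖ ^ 2) :=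
    mul_nonneg (by linarith) (by have : ‖y‖ ^ 2 ≤ ‖x‖ ^ 2 := by gcongr
                                 linarith)
  nlinarith [sq_nonneg ‖x - y‖]

/-- `radial ψ` is Lipschitz. -/
theorem norm_radial_sub_le {ψ : ℝ → ℝ} {η ρ : ℝ} (hψ : IsProfile ψ η ρ) (hη : 2 * η ≤ 1)
    (x y : X) : ‖radial ψ x - radial ψ y‖ ≤ 3 * ‖x - y‖ := by
  set g := (x - y) - (radial ψ x - radial ψ y) with hg
  have h := norm_sq_complement_sub_le hψ hη x y
  rw [← hg] at h
  have h1 := real_inner_le_norm g (x - y)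
  have h2 : ‖g‖ ≤ 2 * ‖x - y‖ := by
    by_contra! hc
    have : 0 ≤ ‖x - y‖ := norm_nonneg _
    nlinarith
  calc ‖radial ψ x - radial ψ y‖ = ‖(x - y) - g‖ := by rw [hg]; congr 1; abel
    _ ≤ ‖x - y‖ + ‖g‖ := norm_sub_le _ _
    _ ≤ 3 * ‖x - y‖ := by linarith

end Radial

/-! ### Periodic extension of a field supported near the origin -/

section Periodize

variable {X : Type*} [NormedAddCommGroup X]

open Classical in
/-- The extension of `R`, supported in the ball of radius `r`, by translations in `Γ`. -/
def periodize (Γ : AddSubgroup X) (r : ℝ) (R : X → X) (x : X) : X :=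
  if h : ∃ γ ∈ Γ, ‖x - γ‖ < 2 * r then R (x - h.choose) else 0

variable {Γ : AddSubgroup X} {r : ℝ} {R : X → X}

theorem periodize_eq_zero {x : X} (h : ∀ γ ∈ Γ, 2 * r ≤ ‖x - γ‖) : periodize Γ r R x = 0 := by
  rw [periodize, dif_neg]
  push Not
  exact h

theorem periodize_eq (hsep : ∀ γ ∈ Γ, γ ≠ 0 → 8 * r ≤ ‖γ‖) {x γ : X} (hγ : γ ∈ Γ)
    (hx : ‖x - γ‖ < 2 * r) : periodize Γ r R x = R (x - γ) := by
  have h : ∃ γ ∈ Γ, ‖x - γ‖ < 2 * r := ⟨γ, hγ, hx⟩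
  rw [periodize, dif_pos h]
  have h1 := h.choose_spec
  by_contra hne
  have h2 : h.choose - γ ≠ 0 := fun h0 => hne (by rw [sub_eq_zero.1 h0])
  have h3 := hsep _ (Γ.sub_mem h1.1 hγ) h2
  have h4 : ‖h.choose - γ‖ ≤ ‖x - γ‖ + ‖x - h.choose‖ := by
    rw [show h.choose - γ = (x - γ) - (x - h.choose) by abel]
    exact norm_sub_le _ _
  have := norm_nonneg (x - γ)
  linarith [h1.2]

/-- Near each point the periodic extension is a translate of the original field. -/
theorem exists_periodize_eq (hr : 0 < r) (hsep : ∀ γ ∈ Γ, γ ≠ 0 → 8 * r ≤ ‖γ‖)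
    (hR : ∀ z, r ≤ ‖z‖ → R z = 0) (x : X) :
    ∃ γ ∈ Γ, ∀ y, ‖y - x‖ < r → periodize Γ r R y = R (y - γ) := by
  -- If `x` is within `3r` of `γ`, a second point of `Γ` within `2r` of `y` would lie within `r + 3r
  -- + 2r` of `γ`, contradicting the separation `8r`. If no such `γ` exists, `y` stays at distance
  -- at least `2r` from `Γ` and the extension vanishes.
  by_cases h : ∃ γ ∈ Γ, ‖x - γ‖ < 3 * r
  · obtain ⟨γ, hγ, hx⟩ := h
    refine ⟨γ, hγ, fun y hy => ?_⟩
    by_cases hy2 : ‖y - γ‖ < 2 * r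
    · exact periodize_eq hsep hγ hy2
    · rw [hR (y - γ) (by linarith), periodize_eq_zero]
      intro γ' hγ'
      by_contra! hlt
      have hne : γ' - γ ≠ 0 := fun h0 => hy2 (by rwa [sub_eq_zero.1 h0] at hlt)
      have h1 := hsep _ (Γ.sub_mem hγ' hγ) hne
      have h2 : ‖γ' - γ‖ ≤ ‖y - x‖ + ‖x - γ‖ + ‖y - γ'‖ := by
        rw [show γ' - γ = ((y - x) + (x - γ)) - (y - γ') by abel]
        exact (norm_sub_le _ _).trans (by gcongr; exact norm_add_le _ _)
      linarith
  · push Not at h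
    have hfar : ∀ y, ‖y - x‖ < r → ∀ γ ∈ Γ, 2 * r ≤ ‖y - γ‖ := fun y hy γ hγ => by
      have h1 := h γ hγ
      have h2 : ‖x - γ‖ ≤ ‖y - γ‖ + ‖y - x‖ := by
        rw [show x - γ = (y - γ) - (y - x) by abel]
        exact norm_sub_le _ _
      linarith
    -- Both sides vanish here, so any element of `Γ` would serve.
    refine ⟨0, Γ.zero_mem, fun y hy => ?_⟩
    rw [periodize_eq_zero (hfar y hy), hR]
    have := hfar y hy 0 Γ.zero_mem
    linarith

theorem periodize_add (hsep : ∀ γ ∈ Γ, γ ≠ 0 → 8 * r ≤ ‖γ‖) (x : X) {γ : X} (hγ : γ ∈ Γ) :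
    periodize Γ r R (x + γ) = periodize Γ r R x := by
  by_cases h : ∃ γ ∈ Γ, ‖x - γ‖ < 2 * r
  · obtain ⟨γ', hγ', hx⟩ := h
    have e : x + γ - (γ' + γ) = x - γ' := by abel
    rw [periodize_eq hsep hγ' hx, periodize_eq hsep (Γ.add_mem hγ' hγ) (by rwa [e]), e]
  · push Not at h
    rw [periodize_eq_zero h, periodize_eq_zero]
    intro γ' hγ'
    have := h _ (Γ.sub_mem hγ' hγ)
    rwa [show x + γ - γ' = x - (γ' - γ) by abel]

theorem exists_norm_lt_of_periodize_ne_zero (hsep : ∀ γ ∈ Γ, γ ≠ 0 → 8 * r ≤ ‖γ‖)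
    (hR : ∀ z, r ≤ ‖z‖ → R z = 0) {x : X} (hx : periodize Γ r R x ≠ 0) :
    ∃ γ ∈ Γ, ‖x - γ‖ < r := by
  by_cases h : ∃ γ ∈ Γ, ‖x - γ‖ < 2 * r
  · obtain ⟨γ, hγ, hlt⟩ := h
    rw [periodize_eq hsep hγ hlt] at hx
    exact ⟨γ, hγ, not_le.1 fun hle => hx (hR _ hle)⟩
  · push Not at h
    exact absurd (periodize_eq_zero h) hx

theorem periodize_eventuallyEq (hr : 0 < r) (hsep : ∀ γ ∈ Γ, γ ≠ 0 → 8 * r ≤ ‖γ‖)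
    (hR : ∀ z, r ≤ ‖z‖ → R z = 0) (x : X) :
    ∃ γ ∈ Γ, periodize Γ r R =ᶠ[nhds x] fun y => R (y - γ) := by
  obtain ⟨γ, hγ, h⟩ := exists_periodize_eq hr hsep hR x
  refine ⟨γ, hγ, ?_⟩
  filter_upwards [Metric.ball_mem_nhds x hr] with y hy
  exact h y (by rwa [← dist_eq_norm])

theorem contDiff_periodize [NormedSpace ℝ X] (hr : 0 < r)
    (hsep : ∀ γ ∈ Γ, γ ≠ 0 → 8 * r ≤ ‖γ‖)
    (hR : ∀ z, r ≤ ‖z‖ → R z = 0) (hs : ContDiff ℝ ∞ R) : ContDiff ℝ ∞ (periodize Γ r R) := by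
  rw [contDiff_iff_contDiffAt]
  intro x
  obtain ⟨γ, -, h⟩ := periodize_eventuallyEq hr hsep hR x
  exact ContDiffAt.congr_of_eventuallyEq
    (hs.comp (contDiff_id.sub contDiff_const)).contDiffAt h

end Periodize

/-! ### Diagonal operators -/

section Diag

variable {ι : Type*} [Fintype ι]

/-- The diagonal operator with entries `a`. -/
def diag (a : ι → ℝ) : EuclideanSpace ℝ ι →L[ℝ] EuclideanSpace ℝ ι :=
  LinearMap.toContinuousLinearMap
    { toFun := fun v => WithLp.toLp 2 fun i => a i * v i
      map_add' := fun v w => by ext i; simp [mul_add]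
      map_smul' := fun c v => by ext i; simp [mul_left_comm] }

@[simp] theorem diag_apply (a : ι → ℝ) (v : EuclideanSpace ℝ ι) (i : ι) :
    diag a v i = a i * v i := rfl

/-- The entries matter only on the support of `v`, so bounds on one spectral block apply directly to
the vectors of that block. -/
theorem norm_diag_le {a : ι → ℝ} {C : ℝ} (hC : 0 ≤ C) {v : EuclideanSpace ℝ ι}
    (h : ∀ i, v i ≠ 0 → |a i| ≤ C) : ‖diag a v‖ ≤ C * ‖v‖ := by
  refine (sq_le_sq₀ (by positivity) (by positivity)).1 ?_
  rw [mul_pow, EuclideanSpace.norm_sq_eq, EuclideanSpace.norm_sq_eq, Finset.mul_sum]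
  refine Finset.sum_le_sum fun i _ => ?_
  rw [diag_apply, norm_mul, mul_pow]
  by_cases hi : v i = 0
  · simp [hi]
  · have := h i hi
    rw [Real.norm_eq_abs]
    gcongr

theorem le_norm_diag {a : ι → ℝ} {C : ℝ} (hC : 0 ≤ C) {v : EuclideanSpace ℝ ι}
    (h : ∀ i, v i ≠ 0 → C ≤ |a i|) : C * ‖v‖ ≤ ‖diag a v‖ := by
  refine (sq_le_sq₀ (by positivity) (by positivity)).1 ?_
  rw [mul_pow, EuclideanSpace.norm_sq_eq, EuclideanSpace.norm_sq_eq, Finset.mul_sum]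
  refine Finset.sum_le_sum fun i _ => ?_
  rw [diag_apply, norm_mul, mul_pow]
  by_cases hi : v i = 0
  · simp [hi]
  · have : C ≤ ‖a i‖ := h i hi
    gcongr

end Diag

/-! ### The model map -/

/-- The eigenvalues `ν` of a diagonal partially hyperbolic operator; the label `τ` is `0`, `1`, `2`
on the strongly stable, central and strongly unstable coordinates. -/
structure SpectralData (ι : Type*) where
  ν : ι → ℝ
  τ : ι → Fin 3
  α : ℝ
  β : ℝ
  β' : ℝ
  κ : ℝ
  α_nonneg : 0 ≤ α
  α_lt : α < β
  β_lt : β < 1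
  lt_β' : 1 < β'
  β'_lt : β' < κ
  ν_ne_zero : ∀ i, ν i ≠ 0
  stable : ∀ i, τ i = 0 → |ν i| ≤ α
  center : ∀ i, τ i = 1 → β ≤ ν i ∧ ν i ≤ β' ∧ ν i ≠ 1
  unstable : ∀ i, τ i = 2 → κ ≤ |ν i|

namespace SpectralData

variable {ι : Type*} (S : SpectralData ι)

/-- A quarter of the spectral gap. -/
def margin : ℝ := min (S.β - S.α) (S.κ - S.β') / 4

theorem margin_pos : 0 < S.margin := by
  have := S.α_lt
  have := S.β'_lt
  have : 0 < min (S.β - S.α) (S.κ - S.β') := lt_min (by linarith) (by linarith)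
  unfold margin
  linarith

theorem margin_le : 4 * S.margin ≤ S.β - S.α := by
  have := min_le_left (S.β - S.α) (S.κ - S.β')
  unfold margin
  linarith

theorem margin_le' : 4 * S.margin ≤ S.κ - S.β' := by
  have := min_le_right (S.β - S.α) (S.κ - S.β')
  unfold margin
  linarith

theorem margin_lt : S.margin < S.β := by
  linarith [S.margin_le, S.margin_pos, S.α_nonneg]

theorem β'_pos : 0 < S.β' := zero_lt_one.trans S.lt_β'

/-- The central part of `ν - 1`. -/
def δ (i : ι) : ℝ := if S.τ i = 1 then S.ν i - 1 else 0

theorem abs_δ_le (i : ι) : |S.δ i| ≤ S.β' := by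
  unfold δ
  have h1 := S.α_nonneg
  have h2 := S.α_lt
  have h3 := S.lt_β'
  split_ifs with h
  · have := S.center i h
    rw [abs_le]; constructor <;> linarith
  · simpa using S.β'_pos.le

/-- The coordinate projections of the splitting. -/
def P [Fintype ι] (j : Fin 3) : EuclideanSpace ℝ ι →L[ℝ] EuclideanSpace ℝ ι :=
  diag fun i => if S.τ i = j then 1 else 0

variable [Fintype ι]

theorem P_apply (j : Fin 3) (v : EuclideanSpace ℝ ι) (i : ι) :
    S.P j v i = if S.τ i = j then v i else 0 := by
  simp [P]

end SpectralData

/-- The data of a local perturbation of a diagonal map, repeated along a discrete subgroup. -/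
structure Model (ι : Type*) [Fintype ι] extends SpectralData ι where
  Γ : AddSubgroup (EuclideanSpace ℝ ι)
  r : ℝ
  ψ : ℝ → ℝ
  r_pos : 0 < r
  sep : ∀ γ ∈ Γ, γ ≠ 0 → 8 * r ≤ ‖γ‖
  -- The radial derivative errs by `2η` and `diag δ` multiplies this by at most `β'`, so this `η`
  -- gives a total error of `margin`.
  profile : IsProfile ψ (toSpectralData.margin / (2 * β')) (r ^ 2)

namespace Model

variable {ι : Type*} [Fintype ι] (𝓜 : Model ι)

/-- The smallness of `η` demanded by the cocoercivity estimate; it follows from `margin < β < 1 <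
β'`. -/
theorem two_mul_le_one : 2 * (𝓜.margin / (2 * 𝓜.β')) ≤ 1 := by
  have h1 := 𝓜.margin_lt
  have h2 := 𝓜.β_lt
  have h3 := 𝓜.lt_β'
  have h4 := 𝓜.β'_pos
  rw [show 2 * (𝓜.margin / (2 * 𝓜.β')) = 𝓜.margin / 𝓜.β' by field_simp, div_le_one h4]
  linarith

/-- The periodic radial vector field. -/
def field : EuclideanSpace ℝ ι → EuclideanSpace ℝ ι := periodize 𝓜.Γ 𝓜.r (radial 𝓜.ψ)

theorem radial_zero_of_le (z : EuclideanSpace ℝ ι) (hz : 𝓜.r ≤ ‖z‖) : radial 𝓜.ψ z = 0 :=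
  radial_eq_zero 𝓜.profile 𝓜.r_pos.le hz

theorem contDiff_field : ContDiff ℝ ∞ 𝓜.field :=
  contDiff_periodize 𝓜.r_pos 𝓜.sep 𝓜.radial_zero_of_le (contDiff_radial 𝓜.profile.smooth)

theorem norm_field_le (x : EuclideanSpace ℝ ι) : ‖𝓜.field x‖ ≤ 𝓜.r := by
  obtain ⟨γ, -, h⟩ := exists_periodize_eq 𝓜.r_pos 𝓜.sep 𝓜.radial_zero_of_le x
  rw [field, h x (by simpa using 𝓜.r_pos)]
  exact norm_radial_le 𝓜.profile 𝓜.r_pos.le _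

/-- The perturbed map, with strength `s`. -/
def map (s : ℝ) (x : EuclideanSpace ℝ ι) : EuclideanSpace ℝ ι :=
  diag 𝓜.ν x - s • diag 𝓜.δ (𝓜.field x)

/-- The derivative of the perturbed map at a point at position `z` with respect to `Γ`. -/
def locDeriv (s : ℝ) (z : EuclideanSpace ℝ ι) : EuclideanSpace ℝ ι →L[ℝ] EuclideanSpace ℝ ι :=
  diag 𝓜.ν - s • (diag 𝓜.δ).comp (radialDeriv 𝓜.ψ z)

theorem contDiff_map_uncurry :
    ContDiff ℝ ∞ fun q : ℝ × EuclideanSpace ℝ ι => 𝓜.map q.1 q.2 := by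
  unfold map
  have := 𝓜.contDiff_field
  fun_prop

theorem contDiff_map (s : ℝ) : ContDiff ℝ ∞ (𝓜.map s) :=
  𝓜.contDiff_map_uncurry.comp (contDiff_const.prodMk contDiff_id)

theorem exists_hasFDerivAt (x : EuclideanSpace ℝ ι) :
    ∃ γ ∈ 𝓜.Γ, ∀ s, HasFDerivAt (𝓜.map s) (𝓜.locDeriv s (x - γ)) x := by
  obtain ⟨γ, hγ, h⟩ := periodize_eventuallyEq 𝓜.r_pos 𝓜.sep 𝓜.radial_zero_of_le x
  refine ⟨γ, hγ, fun s => ?_⟩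
  have h1 : HasFDerivAt 𝓜.field (radialDeriv 𝓜.ψ (x - γ)) x := by
    refine HasFDerivAt.congr_of_eventuallyEq ?_ h
    have h2 := (hasFDerivAt_radial 𝓜.profile.smooth (x - γ)).comp x
      ((hasFDerivAt_id x).sub_const γ)
    rwa [ContinuousLinearMap.comp_id] at h2
  exact (diag 𝓜.ν).hasFDerivAt.sub (((diag 𝓜.δ).hasFDerivAt.comp x h1).const_smul s)

theorem hasFDerivAt_zero (s : ℝ) : HasFDerivAt (𝓜.map s) (𝓜.locDeriv s 0) 0 := by
  have h1 : HasFDerivAt 𝓜.field (radialDeriv 𝓜.ψ 0) 0 := by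
    refine HasFDerivAt.congr_of_eventuallyEq (hasFDerivAt_radial 𝓜.profile.smooth 0) ?_
    have hr := 𝓜.r_pos
    filter_upwards [Metric.ball_mem_nhds 0 hr] with y hy
    rw [field, periodize_eq 𝓜.sep 𝓜.Γ.zero_mem, sub_zero]
    simp at hy ⊢
    linarith
  exact (diag 𝓜.ν).hasFDerivAt.sub (((diag 𝓜.δ).hasFDerivAt.comp 0 h1).const_smul s)

theorem map_zero_right (s : ℝ) : 𝓜.map s 0 = 0 := by
  have hr := 𝓜.r_pos
  rw [map, field, periodize_eq 𝓜.sep 𝓜.Γ.zero_mem (by simpa)]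
  simp [radial]

/-- The map is linear in the noncentral directions because `δ` vanishes there. This triangular
structure keeps the linear centre invariant and makes the strong bundles graphs. -/
theorem map_apply_of_ne (s : ℝ) (x : EuclideanSpace ℝ ι) {i : ι} (hi : 𝓜.τ i ≠ 1) :
    𝓜.map s x i = 𝓜.ν i * x i := by
  simp [map, SpectralData.δ, hi]

theorem locDeriv_apply_of_ne (s : ℝ) (z v : EuclideanSpace ℝ ι) {i : ι} (hi : 𝓜.τ i ≠ 1) :
    𝓜.locDeriv s z v i = 𝓜.ν i * v i := by
  simp [locDeriv, SpectralData.δ, hi]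

variable {s : ℝ}

/-- The derivative is diagonal up to a small error. -/
theorem norm_locDeriv_sub_le (hs : s ∈ Set.Icc (0 : ℝ) 1) (z v : EuclideanSpace ℝ ι) :
    ‖𝓜.locDeriv s z v - diag (fun i => 𝓜.ν i - s * 𝓜.ψ (‖z‖ ^ 2) * 𝓜.δ i) v‖ ≤
      𝓜.margin * ‖v‖ := by
  have e : 𝓜.locDeriv s z v - diag (fun i => 𝓜.ν i - s * 𝓜.ψ (‖z‖ ^ 2) * 𝓜.δ i) v =
      -(s • diag 𝓜.δ (radialDeriv 𝓜.ψ z v - 𝓜.ψ (‖z‖ ^ 2) • v)) := by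
    ext i
    simp [locDeriv]
    ring
  have hb := 𝓜.β'_pos
  rw [e, norm_neg, norm_smul, Real.norm_eq_abs, abs_of_nonneg hs.1]
  calc s * ‖diag 𝓜.δ (radialDeriv 𝓜.ψ z v - 𝓜.ψ (‖z‖ ^ 2) • v)‖
      ≤ 1 * (𝓜.β' * (2 * (𝓜.margin / (2 * 𝓜.β')) * ‖v‖)) := by
        gcongr
        · exact hs.2
        · refine (norm_diag_le hb.le fun i _ => 𝓜.abs_δ_le i).trans ?_
          gcongr
          exact norm_radialDeriv_sub_le 𝓜.profile z v
    _ = 𝓜.margin * ‖v‖ := by field_simp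

/-- The entry is the convex combination of `ν i` and `1` with weight `s ψ(t)` on `1`, and both lie
in the interval. -/
theorem diagonal_mem (hs : s ∈ Set.Icc (0 : ℝ) 1) (t : ℝ) {i : ι} (hi : 𝓜.τ i = 1) :
    𝓜.ν i - s * 𝓜.ψ t * 𝓜.δ i ∈ Set.Icc 𝓜.β 𝓜.β' := by
  have h0 := mul_nonneg hs.1 (𝓜.profile.nonneg t)
  have h1 : s * 𝓜.ψ t ≤ 1 := mul_le_one₀ hs.2 (𝓜.profile.nonneg t) (𝓜.profile.le_one t)
  obtain ⟨h2, h3, -⟩ := 𝓜.center i hi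
  have := 𝓜.β_lt
  have := 𝓜.lt_β'
  simp only [SpectralData.δ, hi, if_true]
  set c := s * 𝓜.ψ t
  constructor <;> nlinarith

theorem norm_locDeriv_le (hs : s ∈ Set.Icc (0 : ℝ) 1) (z : EuclideanSpace ℝ ι)
    {v : EuclideanSpace ℝ ι} (hv : ∀ i, 𝓜.τ i ≠ 1 → v i = 0) :
    ‖𝓜.locDeriv s z v‖ ≤ (𝓜.β' + 𝓜.margin) * ‖v‖ := by
  have h1 := 𝓜.norm_locDeriv_sub_le hs z v
  have h2 : ‖diag (fun i => 𝓜.ν i - s * 𝓜.ψ (‖z‖ ^ 2) * 𝓜.δ i) v‖ ≤ 𝓜.β' * ‖v‖ :=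
    norm_diag_le 𝓜.β'_pos.le fun i hi => by
      have := 𝓜.diagonal_mem hs (‖z‖ ^ 2) (not_not.1 (mt (hv i) hi))
      have h3 := 𝓜.margin_lt
      have h4 := 𝓜.margin_pos
      rw [abs_of_nonneg (by linarith [this.1])]
      exact this.2
  have := norm_le_norm_add_norm_sub' (𝓜.locDeriv s z v)
    (diag (fun i => 𝓜.ν i - s * 𝓜.ψ (‖z‖ ^ 2) * 𝓜.δ i) v)
  linarith

/-- Strong monotonicity along the centre, which survives the error term since `margin < β`. It
yields the lower central rate and the injectivity of both the derivative and the map. -/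
theorem inner_locDeriv_ge (hs : s ∈ Set.Icc (0 : ℝ) 1) (z : EuclideanSpace ℝ ι)
    {v : EuclideanSpace ℝ ι} (hv : ∀ i, 𝓜.τ i ≠ 1 → v i = 0) :
    (𝓜.β - 𝓜.margin) * ‖v‖ ^ 2 ≤ inner ℝ (𝓜.locDeriv s z v) v := by
  set w := diag (fun i => 𝓜.ν i - s * 𝓜.ψ (‖z‖ ^ 2) * 𝓜.δ i) v with hw
  have h1 : 𝓜.β * ‖v‖ ^ 2 ≤ inner ℝ w v := by
    rw [EuclideanSpace.norm_sq_eq, Finset.mul_sum, PiLp.inner_apply]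
    refine Finset.sum_le_sum fun i _ => ?_
    simp only [hw, diag_apply, Real.norm_eq_abs, sq_abs, RCLike.inner_apply, conj_trivial]
    by_cases hi : v i = 0
    · simp [hi]
    · have := (𝓜.diagonal_mem hs (‖z‖ ^ 2) (not_not.1 (mt (hv i) hi))).1
      nlinarith [sq_nonneg (v i)]
  have h2 := 𝓜.norm_locDeriv_sub_le hs z v
  have h3 := (abs_le.1 (abs_real_inner_le_norm (𝓜.locDeriv s z v - w) v)).1
  have h4 : ‖𝓜.locDeriv s z v - w‖ * ‖v‖ ≤ 𝓜.margin * ‖v‖ * ‖v‖ := by gcongr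
  rw [inner_sub_left] at h3
  nlinarith

theorem le_norm_locDeriv (hs : s ∈ Set.Icc (0 : ℝ) 1) (z : EuclideanSpace ℝ ι)
    {v : EuclideanSpace ℝ ι} (hv : ∀ i, 𝓜.τ i ≠ 1 → v i = 0) :
    (𝓜.β - 𝓜.margin) * ‖v‖ ≤ ‖𝓜.locDeriv s z v‖ := by
  have h1 := 𝓜.inner_locDeriv_ge hs z hv
  have h2 := real_inner_le_norm (𝓜.locDeriv s z v) v
  rcases (norm_nonneg v).eq_or_lt with h | h
  · rw [← h, mul_zero]; exact norm_nonneg _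
  · by_contra! hc
    nlinarith

theorem locDeriv_injective (hs : s ∈ Set.Icc (0 : ℝ) 1) (z : EuclideanSpace ℝ ι) :
    Function.Injective (𝓜.locDeriv s z) := by
  rw [injective_iff_map_eq_zero]
  intro v hv
  have hc : ∀ i, 𝓜.τ i ≠ 1 → v i = 0 := fun i hi => by
    have := 𝓜.locDeriv_apply_of_ne s z v hi
    rw [hv] at this
    simpa [𝓜.ν_ne_zero i] using this.symm
  have h := 𝓜.le_norm_locDeriv hs z hc
  rw [hv, norm_zero] at h
  have := 𝓜.margin_lt
  have : ‖v‖ ≤ 0 := by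
    by_contra! h0
    nlinarith
  simpa using this

/-- The derivative as a linear equivalence. -/
def locEquiv (hs : s ∈ Set.Icc (0 : ℝ) 1) (z : EuclideanSpace ℝ ι) :
    EuclideanSpace ℝ ι ≃L[ℝ] EuclideanSpace ℝ ι :=
  (LinearEquiv.ofInjectiveEndo (𝓜.locDeriv s z : EuclideanSpace ℝ ι →ₗ[ℝ] EuclideanSpace ℝ ι)
    (𝓜.locDeriv_injective hs z)).toContinuousLinearEquiv

theorem coe_locEquiv (hs : s ∈ Set.Icc (0 : ℝ) 1) (z : EuclideanSpace ℝ ι) :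
    (𝓜.locEquiv hs z : EuclideanSpace ℝ ι →L[ℝ] EuclideanSpace ℝ ι) = 𝓜.locDeriv s z := rfl

theorem map_injective (hs : s ∈ Set.Icc (0 : ℝ) 1) : Function.Injective (𝓜.map s) := by
  intro x y hxy
  have hc : ∀ i, 𝓜.τ i ≠ 1 → (x - y) i = 0 := fun i hi => by
    have h1 := 𝓜.map_apply_of_ne s x hi
    rw [hxy, 𝓜.map_apply_of_ne s y hi] at h1
    have := mul_left_cancel₀ (𝓜.ν_ne_zero i) h1
    simp [this]
  -- the map is strictly monotone along central segments
  set w := x - y with hw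
  have hd : ∀ t : ℝ, ∃ z, HasDerivAt (fun t : ℝ => inner ℝ (𝓜.map s (y + t • w)) w)
      (inner ℝ (𝓜.locDeriv s z w) w) t := fun t => by
    obtain ⟨γ, -, h⟩ := 𝓜.exists_hasFDerivAt (y + t • w)
    refine ⟨y + t • w - γ, ?_⟩
    have h1 : HasDerivAt (fun t : ℝ => y + t • w) w t := by
      simpa using ((hasDerivAt_id t).smul_const w).const_add y
    have h2 := (h s).comp_hasDerivAt t h1
    simpa using h2.inner ℝ (hasDerivAt_const t w)
  choose z hz using hd
  have := Convex.mul_sub_le_image_sub_of_le_deriv (convex_univ (𝕜 := ℝ) (E := ℝ))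
    (f := fun t : ℝ => inner ℝ (𝓜.map s (y + t • w)) w) (C := (𝓜.β - 𝓜.margin) * ‖w‖ ^ 2)
    (fun t _ => (hz t).continuousAt.continuousWithinAt)
    (fun t _ => (hz t).differentiableAt.differentiableWithinAt)
    (fun t _ => by rw [(hz t).deriv]; exact 𝓜.inner_locDeriv_ge hs _ hc)
    0 (Set.mem_univ _) 1 (Set.mem_univ _) zero_le_one
  simp only [one_smul, zero_smul, add_zero] at this
  rw [show y + w = x by rw [hw]; abel, hxy, sub_self, sub_zero, mul_one] at this
  have h1 := 𝓜.margin_lt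
  have h2 : ‖w‖ ^ 2 ≤ 0 := by
    by_contra! h0
    nlinarith
  have h3 : w = 0 := by simpa using h2
  exact sub_eq_zero.1 h3

theorem isOpenMap_map (hs : s ∈ Set.Icc (0 : ℝ) 1) : IsOpenMap (𝓜.map s) := by
  rw [isOpenMap_iff_nhds_le]
  intro x
  obtain ⟨γ, -, h⟩ := 𝓜.exists_hasFDerivAt x
  have h1 : HasStrictFDerivAt (𝓜.map s)
      (𝓜.locEquiv hs (x - γ) : EuclideanSpace ℝ ι →L[ℝ] EuclideanSpace ℝ ι) x := by
    rw [coe_locEquiv, ← (h s).fderiv]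
    exact (𝓜.contDiff_map s).contDiffAt.hasStrictFDerivAt (by simp)
  exact h1.map_nhds_eq_of_equiv.ge

/-- The map is proper: it differs from an invertible linear map by a bounded term, so preimages of
bounded sequences are bounded. Together with openness this gives surjectivity. -/
theorem isClosed_range_map (hs : s ∈ Set.Icc (0 : ℝ) 1) : IsClosed (Set.range (𝓜.map s)) := by
  have hc : Continuous (𝓜.map s) := (𝓜.contDiff_map s).continuous
  have hinv : ∀ x, ‖x‖ ≤ ‖diag (fun i => (𝓜.ν i)⁻¹)‖ * (‖𝓜.map s x‖ + 𝓜.β' * 𝓜.r) := fun x => by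
    have e : x = diag (fun i => (𝓜.ν i)⁻¹) (𝓜.map s x + s • diag 𝓜.δ (𝓜.field x)) := by
      ext i
      simp [map, 𝓜.ν_ne_zero i]
    conv_lhs => rw [e]
    refine (ContinuousLinearMap.le_opNorm _ _).trans ?_
    gcongr
    refine (norm_add_le _ _).trans ?_
    gcongr
    rw [norm_smul, Real.norm_eq_abs, abs_of_nonneg hs.1]
    have hb := 𝓜.β'_pos
    calc s * ‖diag 𝓜.δ (𝓜.field x)‖ ≤ 1 * (𝓜.β' * 𝓜.r) := by
          gcongr
          · exact hs.2
          · refine (norm_diag_le hb.le fun i _ => 𝓜.abs_δ_le i).trans ?_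
            gcongr
            exact 𝓜.norm_field_le x
      _ = _ := one_mul _
  refine IsSeqClosed.isClosed fun u y hu hy => ?_
  choose x hx using hu
  obtain ⟨C, hC⟩ := (Metric.isBounded_range_of_tendsto _ hy).exists_norm_le
  have hb : ∀ k, x k ∈ Metric.closedBall (0 : EuclideanSpace ℝ ι)
      (‖diag (fun i => (𝓜.ν i)⁻¹)‖ * (C + 𝓜.β' * 𝓜.r)) := fun k => by
    rw [mem_closedBall_zero_iff]
    refine (hinv (x k)).trans ?_
    gcongr
    rw [hx k]
    exact hC _ (Set.mem_range_self k)
  obtain ⟨a, -, φ, hφ, ha⟩ := (isCompact_closedBall _ _).tendsto_subseq hb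
  refine ⟨a, tendsto_nhds_unique ((hc.tendsto a).comp ha) ?_⟩
  simpa [Function.comp_def, hx] using hy.comp hφ.tendsto_atTop

theorem map_surjective (hs : s ∈ Set.Icc (0 : ℝ) 1) : Function.Surjective (𝓜.map s) := by
  rw [← Set.range_eq_univ]
  exact IsClopen.eq_univ ⟨𝓜.isClosed_range_map hs, (𝓜.isOpenMap_map hs).isOpen_range⟩
    (Set.range_nonempty _)

/-- The perturbed map as a homeomorphism. -/
def homeo (hs : s ∈ Set.Icc (0 : ℝ) 1) : EuclideanSpace ℝ ι ≃ₜ EuclideanSpace ℝ ι :=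
  (Equiv.ofBijective (𝓜.map s) ⟨𝓜.map_injective hs, 𝓜.map_surjective hs⟩).toHomeomorphOfContinuousOpen
    (𝓜.contDiff_map s).continuous (𝓜.isOpenMap_map hs)

theorem contDiff_homeo_symm (hs : s ∈ Set.Icc (0 : ℝ) 1) : ContDiff ℝ ∞ (𝓜.homeo hs).symm := by
  choose γ _ h using 𝓜.exists_hasFDerivAt
  exact (𝓜.homeo hs).contDiff_symm (f₀' := fun x => 𝓜.locEquiv hs (x - γ x))
    (fun x => by rw [coe_locEquiv]; exact h x s) (𝓜.contDiff_map s)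

end Model

/-! ### Descending maps to the torus -/

theorem isOpenQuotientMap_proj {n : ℕ} : IsOpenQuotientMap (proj (n := n)) := by
  have h1 : IsOpenQuotientMap (Pi.map fun _ : Fin n => ((↑) : ℝ → UnitAddCircle)) :=
    IsOpenQuotientMap.piMap fun _ => QuotientAddGroup.isOpenQuotientMap_mk
  exact h1.comp (EuclideanSpace.equiv (Fin n) ℝ).toHomeomorph.isOpenQuotientMap

theorem proj_zero {n : ℕ} : proj (0 : E n) = 0 := by
  funext i
  simp [proj]

theorem proj_sub {n : ℕ} (x y : E n) : proj (x - y) = proj x - proj y := by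
  funext i
  simp [proj]

theorem proj_eq_iff {n : ℕ} {x y : E n} : proj x = proj y ↔ proj (x - y) = 0 := by
  rw [proj_sub, sub_eq_zero]

theorem exists_int_of_proj_eq_zero {n : ℕ} {x : E n} (h : proj x = 0) (i : Fin n) :
    ∃ m : ℤ, x i = m := by
  have h1 : ((x i : ℝ) : UnitAddCircle) = 0 := congrFun h i
  rw [AddCircle.coe_eq_zero_iff] at h1
  obtain ⟨m, hm⟩ := h1
  exact ⟨m, by simpa using hm.symm⟩

theorem one_le_norm_of_proj_eq_zero {n : ℕ} {x : E n} (h : proj x = 0) (hx : x ≠ 0) : 1 ≤ ‖x‖ := by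
  obtain ⟨i, hi⟩ : ∃ i, x i ≠ 0 := by
    by_contra! hc
    exact hx (by ext i; simpa using hc i)
  obtain ⟨m, hm⟩ := exists_int_of_proj_eq_zero h i
  have hm0 : m ≠ 0 := fun h0 => hi (by simp [hm, h0])
  have h1 : (1 : ℝ) ≤ |x i| := by
    rw [hm, ← Int.cast_abs]
    exact_mod_cast Int.one_le_abs hm0
  exact h1.trans (PiLp.norm_apply_le x i)

theorem toralAut_zero {n : ℕ} (A : Matrix.SpecialLinearGroup (Fin n) ℤ) : toralAut A 0 = 0 := by
  rw [← proj_zero, ← proj_linMap, map_zero]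

/-- The permutation of the torus induced by an equivariant permutation of `ℝⁿ`. -/
def descend {n : ℕ} (F : E n ≃ E n) (h : ∀ x y, proj (F x) = proj (F y) ↔ proj x = proj y) :
    Equiv.Perm (Torus n) where
  toFun x := proj (F (Function.surjInv proj_surjective x))
  invFun x := proj (F.symm (Function.surjInv proj_surjective x))
  left_inv x := by
    obtain ⟨y, rfl⟩ := proj_surjective x
    rw [← h, F.apply_symm_apply, Function.surjInv_eq proj_surjective, h,
      Function.surjInv_eq proj_surjective]
  right_inv x := by
    obtain ⟨y, rfl⟩ := proj_surjective x
    change proj (F (Function.surjInv proj_surjective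
      (proj (F.symm (Function.surjInv proj_surjective (proj y)))))) = proj y
    have : proj (F.symm (Function.surjInv proj_surjective (proj y))) = proj (F.symm y) := by
      rw [← h, F.apply_symm_apply, F.apply_symm_apply, Function.surjInv_eq proj_surjective]
    conv_rhs => rw [← F.apply_symm_apply y]
    rw [this, h, Function.surjInv_eq proj_surjective]

section Descend

variable {n : ℕ} {F : E n ≃ E n} (h : ∀ x y, proj (F x) = proj (F y) ↔ proj x = proj y)

theorem descend_proj (x : E n) : descend F h (proj x) = proj (F x) := by
  change proj (F (Function.surjInv proj_surjective (proj x))) = _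
  rw [h, Function.surjInv_eq proj_surjective]

theorem descend_symm_proj (x : E n) : (descend F h).symm (proj x) = proj (F.symm x) := by
  rw [Equiv.symm_apply_eq, descend_proj, F.apply_symm_apply]

theorem isSmoothLift_descend (hF : ContDiff ℝ ∞ F) : IsSmoothLift F (descend F h) :=
  ⟨hF, fun x => (descend_proj h x).symm⟩

theorem isDiffeo_descend (hF : ContDiff ℝ ∞ F) (hF' : ContDiff ℝ ∞ F.symm) :
    IsDiffeo (descend F h) :=
  ⟨⟨F, isSmoothLift_descend h hF⟩, ⟨F.symm, hF', fun x => (descend_symm_proj h x).symm⟩⟩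

end Descend

theorem IsSmooth.continuous {n : ℕ} {f : Torus n → Torus n} (hf : IsSmooth f) : Continuous f := by
  obtain ⟨F, hF⟩ := hf
  rw [← isOpenQuotientMap_proj.continuous_comp_iff]
  have : f ∘ proj = proj ∘ F := funext fun x => (hF.2 x).symm
  rw [this]
  exact isOpenQuotientMap_proj.continuous.comp hF.1.continuous

theorem IsSmooth.continuous_torusDeriv {n : ℕ} {f : Torus n → Torus n} (hf : IsSmooth f) :
    Continuous (torusDeriv f) := by
  obtain ⟨F, hF⟩ := hf
  rw [← isOpenQuotientMap_proj.continuous_comp_iff]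
  have : torusDeriv f ∘ proj = fderiv ℝ F := funext fun x => torusDeriv_proj hF x
  rw [this]
  exact hF.1.continuous_fderiv (by simp)

/-! ### The perturbed toral automorphism -/

/-- A model map whose linear part is the automorphism `A` in the linear coordinates `T`. -/
structure ToralModel {n : ℕ} (A : Matrix.SpecialLinearGroup (Fin n) ℤ) (ι : Type*) [Fintype ι]
    extends Model ι where
  T : E n ≃L[ℝ] EuclideanSpace ℝ ι
  T_linMap : ∀ x, T (linMap A x) = diag ν (T x)
  mem_Γ : ∀ y, y ∈ Γ ↔ proj (T.symm y) = 0

namespace ToralModel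

variable {n : ℕ} {A : Matrix.SpecialLinearGroup (Fin n) ℤ} {ι : Type*} [Fintype ι]
  (𝓣 : ToralModel A ι) {s : ℝ}

/-- The lift of the perturbed automorphism to `ℝⁿ`. -/
def lift (hs : s ∈ Set.Icc (0 : ℝ) 1) : E n ≃ E n :=
  (𝓣.T.toEquiv.trans (𝓣.homeo hs).toEquiv).trans 𝓣.T.symm.toEquiv

theorem lift_apply (hs : s ∈ Set.Icc (0 : ℝ) 1) (x : E n) :
    𝓣.lift hs x = 𝓣.T.symm (𝓣.map s (𝓣.T x)) := rfl

theorem T_lift (hs : s ∈ Set.Icc (0 : ℝ) 1) (x : E n) :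
    𝓣.T (𝓣.lift hs x) = 𝓣.map s (𝓣.T x) := by
  rw [lift_apply, ContinuousLinearEquiv.apply_symm_apply]

theorem contDiff_lift (hs : s ∈ Set.Icc (0 : ℝ) 1) : ContDiff ℝ ∞ (𝓣.lift hs) :=
  𝓣.T.symm.contDiff.comp ((𝓣.contDiff_map s).comp 𝓣.T.contDiff)

theorem contDiff_lift_symm (hs : s ∈ Set.Icc (0 : ℝ) 1) : ContDiff ℝ ∞ (𝓣.lift hs).symm :=
  𝓣.T.symm.contDiff.comp ((𝓣.contDiff_homeo_symm hs).comp 𝓣.T.contDiff)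

/-- The perturbation term is periodic under the lattice, so only the linear part sees the
translation. -/
theorem lift_add (hs : s ∈ Set.Icc (0 : ℝ) 1) (x : E n) {m : E n} (hm : proj m = 0) :
    𝓣.lift hs (x + m) = 𝓣.lift hs x + linMap A m := by
  apply 𝓣.T.injective
  have h1 : 𝓣.T m ∈ 𝓣.Γ := (𝓣.mem_Γ _).2 (by simpa)
  rw [map_add 𝓣.T, T_lift, T_lift, T_linMap, map_add 𝓣.T, Model.map, Model.map, Model.field,
    periodize_add 𝓣.sep _ h1, map_add]
  abel

theorem linMap_surjective (𝓣 : ToralModel A ι) : Function.Surjective (linMap A) := by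
  intro y
  refine ⟨𝓣.T.symm (diag (fun i => (𝓣.ν i)⁻¹) (𝓣.T y)), 𝓣.T.injective ?_⟩
  rw [T_linMap, ContinuousLinearEquiv.apply_symm_apply]
  ext i
  simp [𝓣.ν_ne_zero i]

theorem proj_lift_iff (hs : s ∈ Set.Icc (0 : ℝ) 1) (x y : E n) :
    proj (𝓣.lift hs x) = proj (𝓣.lift hs y) ↔ proj x = proj y := by
  constructor
  · intro h
    -- The difference of the images is integral. Its preimage `m` under `A` is integral too because
    -- `A` is injective on the torus, and then `x = y + m` by injectivity of the lift.
    obtain ⟨m, hm⟩ := 𝓣.linMap_surjective (𝓣.lift hs x - 𝓣.lift hs y)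
    have h1 : proj m = 0 := by
      apply (toralAut A).injective
      rw [← proj_linMap, hm, proj_eq_iff.1 h, toralAut_zero]
    have h2 : 𝓣.lift hs x = 𝓣.lift hs (y + m) := by
      rw [lift_add 𝓣 hs y h1, hm]
      abel
    rw [(𝓣.lift hs).injective h2, proj_add, h1, add_zero]
  · intro h
    have h1 := proj_eq_iff.1 h
    have h2 : x = y + (x - y) := by abel
    rw [h2, lift_add 𝓣 hs y h1, proj_add, proj_linMap, h1, toralAut_zero, add_zero]

/-- The perturbed automorphism of the torus. -/
def perm (hs : s ∈ Set.Icc (0 : ℝ) 1) : Equiv.Perm (Torus n) :=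
  descend (𝓣.lift hs) (𝓣.proj_lift_iff hs)

theorem perm_proj (hs : s ∈ Set.Icc (0 : ℝ) 1) (x : E n) :
    𝓣.perm hs (proj x) = proj (𝓣.lift hs x) := descend_proj _ x

theorem isDiffeo_perm (hs : s ∈ Set.Icc (0 : ℝ) 1) : IsDiffeo (𝓣.perm hs) :=
  isDiffeo_descend _ (𝓣.contDiff_lift hs) (𝓣.contDiff_lift_symm hs)

theorem perm_zero (hs : s ∈ Set.Icc (0 : ℝ) 1) : 𝓣.perm hs 0 = 0 := by
  rw [← proj_zero, perm_proj, lift_apply, map_zero, Model.map_zero_right, map_zero]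

theorem torusDeriv_perm_of_hasFDerivAt (hs : s ∈ Set.Icc (0 : ℝ) 1) {x : E n}
    {M : EuclideanSpace ℝ ι →L[ℝ] EuclideanSpace ℝ ι} (h : HasFDerivAt (𝓣.map s) M (𝓣.T x)) :
    torusDeriv (𝓣.perm hs) (proj x) =
      ((𝓣.T.symm : EuclideanSpace ℝ ι →L[ℝ] E n).comp M).comp
        (𝓣.T : E n →L[ℝ] EuclideanSpace ℝ ι) := by
  rw [perm, torusDeriv_proj (isSmoothLift_descend (𝓣.proj_lift_iff hs) (𝓣.contDiff_lift hs))]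
  refine HasFDerivAt.fderiv ?_
  exact ((𝓣.T.symm.hasFDerivAt (x := 𝓣.map s (𝓣.T x))).comp _ h).comp x
    (𝓣.T.hasFDerivAt (x := x))

/-- The derivative of the perturbed automorphism is conjugate to that of the model map. -/
theorem exists_torusDeriv_perm (hs : s ∈ Set.Icc (0 : ℝ) 1) (x : Torus n) :
    ∃ z, torusDeriv (𝓣.perm hs) x =
      ((𝓣.T.symm : EuclideanSpace ℝ ι →L[ℝ] E n).comp (𝓣.locDeriv s z)).comp
        (𝓣.T : E n →L[ℝ] EuclideanSpace ℝ ι) := by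
  obtain ⟨x, rfl⟩ := proj_surjective x
  obtain ⟨γ, -, h⟩ := 𝓣.exists_hasFDerivAt (𝓣.T x)
  exact ⟨_, 𝓣.torusDeriv_perm_of_hasFDerivAt hs (h s)⟩

theorem perm_eq_toralAut (hs : s ∈ Set.Icc (0 : ℝ) 1) (x : E n)
    (h : s • diag 𝓣.δ (𝓣.field (𝓣.T x)) = 0) :
    𝓣.perm hs (proj x) = toralAut A (proj x) := by
  rw [perm_proj, ← proj_linMap]
  congr 1
  apply 𝓣.T.injective
  rw [T_lift, T_linMap, Model.map, h, sub_zero]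

theorem perm_eq_toralAut_of_notMem (hs : s ∈ Set.Icc (0 : ℝ) 1) {ε : ℝ}
    (hε : ∀ y, ‖y‖ < 𝓣.r → ‖𝓣.T.symm y‖ < ε) (x : Torus n)
    (hx : x ∉ proj '' Metric.ball (0 : E n) ε) : 𝓣.perm hs x = toralAut A x := by
  obtain ⟨x, rfl⟩ := proj_surjective x
  apply perm_eq_toralAut
  have : 𝓣.field (𝓣.T x) = 0 := by
    by_contra hne
    obtain ⟨γ, hγ, hlt⟩ :=
      exists_norm_lt_of_periodize_ne_zero 𝓣.sep 𝓣.radial_zero_of_le hne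
    have h1 := hε _ hlt
    rw [map_sub, ContinuousLinearEquiv.symm_apply_apply] at h1
    refine hx ⟨x - 𝓣.T.symm γ, by simpa using h1, ?_⟩
    rw [proj_sub, (𝓣.mem_Γ γ).1 hγ, sub_zero]
  rw [this, map_zero, smul_zero]

theorem isotopic_perm : Isotopic (𝓣.perm (Set.right_mem_Icc.2 zero_le_one)) (toralAut A) := by
  have hmem : ∀ t ∈ Set.Icc (0 : ℝ) 1, 1 - t ∈ Set.Icc (0 : ℝ) 1 := fun t ht =>
    ⟨by linarith [ht.2], by linarith [ht.1]⟩
  classical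
  refine ⟨fun t => if ht : t ∈ Set.Icc (0 : ℝ) 1 then 𝓣.perm (hmem t ht) else 1,
    fun q => 𝓣.T.symm (𝓣.map (1 - q.1) (𝓣.T q.2)), ?_, ?_, ?_, ?_, ?_⟩
  · simp only [Set.left_mem_Icc, zero_le_one, dite_true]
    congr 1
    simp
  · ext1 x
    obtain ⟨x, rfl⟩ := proj_surjective x
    simp only [Set.right_mem_Icc, zero_le_one, dite_true]
    rw [perm_eq_toralAut]
    simp
  · intro t ht
    simp only [ht, dite_true]
    exact 𝓣.isDiffeo_perm _
  · refine ContDiff.contDiffOn ?_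
    refine 𝓣.T.symm.contDiff.comp (𝓣.contDiff_map_uncurry.comp
      (f := fun q : ℝ × E n => (1 - q.1, 𝓣.T q.2)) ?_)
    exact (contDiff_const.sub contDiff_fst).prodMk (𝓣.T.contDiff.comp contDiff_snd)
  · intro t ht x
    simp only [ht, dite_true]
    rw [perm_proj, lift_apply]

end ToralModel

/-! ### Invariant sections -/

/-- A fibrewise contracting affine equation over a compact space has a continuous solution. -/
theorem exists_continuous_fixedSection {Y X : Type*} [TopologicalSpace Y] [CompactSpace Y]
    [NormedAddCommGroup X] [NormedSpace ℝ X] [CompleteSpace X] (U V : C(Y, X →L[ℝ] X)) (τ : C(Y, Y))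
    (W : X →L[ℝ] X) {q : ℝ} (hq0 : 0 ≤ q) (hq : q < 1) (h : ∀ y, ‖V y‖ * ‖W‖ ≤ q) :
    ∃ L : C(Y, X →L[ℝ] X), ∀ y, L y = U y + V y * L (τ y) * W := by
  lift q to NNReal using hq0
  let Φ : C(Y, X →L[ℝ] X) → C(Y, X →L[ℝ] X) := fun L =>
    ⟨fun y => U y + V y * L (τ y) * W, by fun_prop⟩
  have hΦ : ContractingWith q Φ := by
    refine ⟨by exact_mod_cast hq, LipschitzWith.of_dist_le_mul fun L L' => ?_⟩
    rw [ContinuousMap.dist_le (by positivity)]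
    intro y
    rw [dist_eq_norm]
    change ‖(U y + V y * L (τ y) * W) - (U y + V y * L' (τ y) * W)‖ ≤ q * dist L L'
    have e : (U y + V y * L (τ y) * W) - (U y + V y * L' (τ y) * W) =
        V y * (L (τ y) - L' (τ y)) * W := by
      noncomm_ring
    rw [e]
    calc ‖V y * (L (τ y) - L' (τ y)) * W‖ ≤ ‖V y‖ * ‖L (τ y) - L' (τ y)‖ * ‖W‖ :=
          (norm_mul_le _ _).trans (by gcongr; exact norm_mul_le _ _)
      _ = ‖V y‖ * ‖W‖ * dist (L (τ y)) (L' (τ y)) := by rw [dist_eq_norm]; ring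
      _ ≤ q * dist L L' := by
          gcongr
          · exact h y
          · exact ContinuousMap.dist_apply_le_dist _
  refine ⟨hΦ.fixedPoint, fun y => ?_⟩
  conv_lhs => rw [← hΦ.fixedPoint_isFixedPt.eq]
  rfl

theorem isInternal_of_projections {ι R V : Type*} [DecidableEq ι] [Fintype ι] [Ring R]
    [AddCommGroup V] [Module R V] (S : ι → Submodule R V) (p : ι → V →ₗ[R] V)
    (hmem : ∀ i v, p i v ∈ S i) (hsum : ∀ v, ∑ i, p i v = v)
    (hid : ∀ i, ∀ v ∈ S i, p i v = v) (hzero : ∀ i j, i ≠ j → ∀ v ∈ S j, p i v = 0) :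
    DirectSum.IsInternal S := by
  rw [DirectSum.isInternal_submodule_iff_iSupIndep_and_iSup_eq_top]
  constructor
  · rw [iSupIndep_def]
    intro i
    rw [Submodule.disjoint_def]
    intro v hv hv'
    have hle : (⨆ j, ⨆ (_ : j ≠ i), S j) ≤ LinearMap.ker (p i) :=
      iSup₂_le fun j hj v hv => hzero i j hj.symm v hv
    rw [← hid i v hv]
    exact hle hv'
  · rw [eq_top_iff]
    intro v _
    rw [← hsum v]
    exact Submodule.sum_mem _ fun i _ => Submodule.mem_iSup_of_mem i (hmem i v)

/-! ### Algebra of graph projections and graph transforms. -/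

section GraphProjection

variable {R : Type*} [Ring R] {p p' c L L' : R}

/-- Here `p` is a noncentral coordinate projection, `c` the central one, and `L` maps the range of
`p` to the centre. Then `p L = 0` and `L² = 0`, and `p + L` is the projection onto the graph of `L`
with the same kernel as `p`. -/
theorem graph_mul_self (hp : p * p = p) (hpc : p * c = 0) (h1 : c * L = L) (h2 : L * p = L) :
    (p + L) * (p + L) = p + L := by
  have h3 : p * L = 0 := by rw [← h1, ← mul_assoc, hpc, zero_mul]
  have h4 : L * L = 0 := by
    calc L * L = L * p * L := by rw [h2]
      _ = 0 := by rw [mul_assoc, h3, mul_zero]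
  rw [add_mul, mul_add, mul_add, hp, h2, h3, h4, add_zero, add_zero]

theorem graph_mul_base (hp : p * p = p) (h2 : L * p = L) : (p + L) * p = p + L := by
  rw [add_mul, hp, h2]

theorem base_mul_graph (hp : p * p = p) (hpc : p * c = 0) (h1 : c * L = L) :
    p * (p + L) = p := by
  have h3 : p * L = 0 := by rw [← h1, ← mul_assoc, hpc, zero_mul]
  rw [mul_add, hp, h3, add_zero]

theorem graph_mul_center (hpc : p * c = 0) (h2 : L * p = L) : (p + L) * c = 0 := by
  rw [add_mul, hpc, ← h2, mul_assoc, hpc, mul_zero, add_zero]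

theorem graph_mul_graph (hpp : p * p' = 0) (hpc : p * c = 0)
    (h2 : L * p = L) (h1' : c * L' = L') : (p + L) * (p' + L') = 0 := by
  have h3 : (p + L) * L' = 0 := by
    rw [← h1', ← mul_assoc, graph_mul_center hpc h2, zero_mul]
  rw [mul_add, h3, add_mul, hpp, ← h2, mul_assoc, hpp, mul_zero, add_zero, add_zero]

variable {m m' a a' : R}

/-- The equation for `L'` is the forward graph transform: the invariance relation `m (p + L) = (p +
L') a` solved for `L'`, with `m` the derivative, `a` its linear part and `a'` the inverse of `a`. -/
theorem unstable_graph_properties (hp : p * p = p) (hc : c * c = c)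
    (hcm : c * (m * c) = m * c) (hL : L' = c * m * (a' * p) + m * c * L * (a' * p)) :
    c * L' = L' ∧ L' * p = L' := by
  constructor
  · calc c * L' = (c * c) * m * (a' * p) + c * (m * c) * L * (a' * p) := by rw [hL]; noncomm_ring
      _ = L' := by rw [hc, hcm, hL]
  · calc L' * p = c * m * (a' * (p * p)) + m * c * L * (a' * (p * p)) := by rw [hL]; noncomm_ring
      _ = L' := by rw [hp, hL]

theorem unstable_graph_invariant (hpa : p * a = a * p) (ha : a' * a = 1)
    (hm : m * p = a * p + c * (m * p)) (h1 : c * L = L) (h2 : L * p = L)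
    (hL : L' = c * m * (a' * p) + m * c * L * (a' * p)) : m * (p + L) = (p + L') * a := by
  have h3 : a' * p * a = p := by rw [mul_assoc, hpa, ← mul_assoc, ha, one_mul]
  calc m * (p + L) = m * p + m * (c * (L * p)) := by rw [h2, h1, mul_add]
    _ = a * p + c * (m * p) + m * (c * (L * p)) := by rw [← hm]
    _ = a * p + c * m * (a' * p * a) + m * c * L * (a' * p * a) := by rw [h3]; noncomm_ring
    _ = (p + L') * a := by rw [hL, ← hpa]; noncomm_ring

/-- The same invariance relation solved instead for the graph `L` at the source point, with `m'` the
inverse of the derivative: the backward graph transform. -/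
theorem stable_graph_properties (hp : p * p = p) (hcm : c * (m' * c) = m' * c)
    (hL : L = -(m' * c * m * p) + m' * c * L' * (a * p)) : c * L = L ∧ L * p = L := by
  constructor
  · calc c * L = -(c * (m' * c) * m * p) + c * (m' * c) * L' * (a * p) := by
          rw [hL]; noncomm_ring
      _ = L := by rw [hcm, hL]
  · calc L * p = -(m' * c * m * (p * p)) + m' * c * L' * (a * (p * p)) := by
          rw [hL]; noncomm_ring
      _ = L := by rw [hp, hL]

theorem stable_graph_invariant (hpa : p * a = a * p) (hmm : m * m' = 1)
    (hm : m * p = a * p + c * (m * p)) (h1 : c * L' = L') (h2 : L' * p = L')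
    (hL : L = -(m' * c * m * p) + m' * c * L' * (a * p)) : m * (p + L) = (p + L') * a := by
  calc m * (p + L) = m * p + (-((m * m') * (c * (m * p))) + (m * m') * (c * L') * (a * p)) := by
        rw [hL]; noncomm_ring
    _ = a * p + L' * (p * a) := by rw [hmm, h1, hpa]; nth_rw 1 [hm]; noncomm_ring
    _ = (p + L') * a := by rw [← mul_assoc, h2, ← hpa, add_mul]

end GraphProjection

theorem clm_mul_apply {X : Type*} [NormedAddCommGroup X] [NormedSpace ℝ X] (B C : X →L[ℝ] X)
    (v : X) : (B * C) v = B (C v) := rfl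

/-! ### Bundles described as fixed spaces of projections. -/

section FixedSpace

variable {V X : Type*} [NormedAddCommGroup V] [NormedSpace ℝ V] [NormedAddCommGroup X]
  [NormedSpace ℝ X] (T : V ≃L[ℝ] X)

/-- The fixed space of the operator `Q`, in the coordinates `T`. -/
def fixedSpace (Q : X →L[ℝ] X) : Submodule ℝ V :=
  LinearMap.ker (((Q - 1).comp (T : V →L[ℝ] X) : V →L[ℝ] X) : V →ₗ[ℝ] X)

theorem mem_fixedSpace {Q : X →L[ℝ] X} {v : V} : v ∈ fixedSpace T Q ↔ Q (T v) = T v := by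
  simp [fixedSpace, sub_eq_zero]

theorem symm_mem_fixedSpace {Q : X →L[ℝ] X} {y : X} : T.symm y ∈ fixedSpace T Q ↔ Q y = y := by
  simp [mem_fixedSpace]

theorem map_fixedSpace {Q Q' M M' : X →L[ℝ] X} (hM : M * M' = 1) (h : Q' * (M * Q) = M * Q)
    (h' : Q * (M' * Q') = M' * Q') :
    (fixedSpace T Q).map ((((T.symm : X →L[ℝ] V).comp M).comp (T : V →L[ℝ] X) : V →L[ℝ] V) :
      V →ₗ[ℝ] V) = fixedSpace T Q' := by
  ext w
  simp only [Submodule.mem_map]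
  constructor
  · rintro ⟨v, hv, rfl⟩
    rw [mem_fixedSpace] at hv
    refine (symm_mem_fixedSpace T).2 ?_
    have := congrArg (fun B : X →L[ℝ] X => B (T v)) h
    simpa [hv] using this
  · intro hw
    rw [mem_fixedSpace] at hw
    refine ⟨T.symm (M' (T w)), (symm_mem_fixedSpace T).2 ?_, ?_⟩
    · have := congrArg (fun B : X →L[ℝ] X => B (T w)) h'
      simpa [hw] using this
    · have : M (M' (T w)) = T w := congrArg (fun B : X →L[ℝ] X => B (T w)) hM
      simp [this]

/-- From `Q w = w` and `Q P = Q` one gets `w = Q (P w)`, so `Q` carries the fixed space of `P` onto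
a space containing that of `Q`. Applied in both directions, it shows that a graph has the dimension
of its base. -/
theorem finrank_fixedSpace_le [FiniteDimensional ℝ V] {P Q : X →L[ℝ] X} (hP : P * P = P)
    (h : Q * P = Q) :
    Module.finrank ℝ (fixedSpace T Q) ≤ Module.finrank ℝ (fixedSpace T P) := by
  have hle : fixedSpace T Q ≤ (fixedSpace T P).map
      ((((T.symm : X →L[ℝ] V).comp Q).comp (T : V →L[ℝ] X) : V →L[ℝ] V) : V →ₗ[ℝ] V) := by
    intro w hw
    rw [mem_fixedSpace] at hw
    refine ⟨T.symm (P (T w)), (symm_mem_fixedSpace T).2 ?_, ?_⟩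
    · exact congrArg (fun B : X →L[ℝ] X => B (T w)) hP
    · have : Q (P (T w)) = Q (T w) := congrArg (fun B : X →L[ℝ] X => B (T w)) h
      simp [this, hw]
  exact (Submodule.finrank_mono hle).trans (Submodule.finrank_map_le _ _)

theorem isClosed_fixedSpace {Y : Type*} [TopologicalSpace Y] {Q : Y → X →L[ℝ] X}
    (hQ : Continuous Q) : IsClosed {q : Y × V | q.2 ∈ fixedSpace T (Q q.1)} := by
  simp only [mem_fixedSpace]
  exact isClosed_eq ((hQ.comp continuous_fst).clm_apply (T.continuous.comp continuous_snd))
    (T.continuous.comp continuous_snd)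

end FixedSpace

/-! ### The invariant splitting of the perturbed automorphism -/

namespace SpectralData

variable {ι : Type*} [Fintype ι] (S : SpectralData ι)

theorem P_mul_self (j : Fin 3) : S.P j * S.P j = S.P j := by
  ext v i
  by_cases h : S.τ i = j <;> simp [P_apply, h]

theorem P_mul_of_ne {j k : Fin 3} (hjk : j ≠ k) : S.P j * S.P k = 0 := by
  ext v i
  by_cases h : S.τ i = j
  · simp [P_apply, h, hjk]
  · simp [P_apply, h]

theorem sum_P : S.P 0 + S.P 1 + S.P 2 = 1 := by
  ext v i
  have : ∀ k : Fin 3, k = 0 ∨ k = 1 ∨ k = 2 := by decide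
  rcases this (S.τ i) with h | h | h <;> simp [P_apply, h]

theorem P_mul_diag (j : Fin 3) (a : ι → ℝ) : S.P j * diag a = diag a * S.P j := by
  ext v i
  simp [P_apply]

theorem norm_P_apply_le (j : Fin 3) (v : EuclideanSpace ℝ ι) : ‖S.P j v‖ ≤ ‖v‖ := by
  have := norm_diag_le (a := fun i => if S.τ i = j then (1 : ℝ) else 0) zero_le_one (v := v)
    fun i _ => by split_ifs <;> simp
  rwa [one_mul] at this

theorem diag_inv_mul_diag : diag (fun i => (S.ν i)⁻¹) * diag S.ν = 1 := by
  ext v i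
  simp [S.ν_ne_zero i]

theorem diag_mul_diag_inv : diag S.ν * diag (fun i => (S.ν i)⁻¹) = 1 := by
  ext v i
  simp [S.ν_ne_zero i]

theorem P_apply_eq_self_iff {v : EuclideanSpace ℝ ι} {j : Fin 3} :
    S.P j v = v ↔ ∀ i, S.τ i ≠ j → v i = 0 := by
  constructor
  · intro h i hi
    rw [← h, P_apply, if_neg hi]
  · intro h
    ext i
    rw [P_apply]
    split_ifs with hi
    · rfl
    · exact (h i hi).symm

end SpectralData

namespace ToralModel

variable {n : ℕ} {A : Matrix.SpecialLinearGroup (Fin n) ℤ} {ι : Type*} [Fintype ι]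
  (𝓣 : ToralModel A ι) {s : ℝ} (hs : s ∈ Set.Icc (0 : ℝ) 1)

/-- The derivative of the perturbed automorphism in the coordinates `T`. -/
def M (x : Torus n) : EuclideanSpace ℝ ι →L[ℝ] EuclideanSpace ℝ ι :=
  ((𝓣.T : E n →L[ℝ] EuclideanSpace ℝ ι).comp (torusDeriv (𝓣.perm hs) x)).comp
    (𝓣.T.symm : EuclideanSpace ℝ ι →L[ℝ] E n)

theorem torusDeriv_eq (x : Torus n) : torusDeriv (𝓣.perm hs) x =
    ((𝓣.T.symm : EuclideanSpace ℝ ι →L[ℝ] E n).comp (𝓣.M hs x)).comp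
        (𝓣.T : E n →L[ℝ] EuclideanSpace ℝ ι) := by
  ext1 v
  simp [M]

theorem exists_M_eq (x : Torus n) : ∃ z, 𝓣.M hs x = 𝓣.locDeriv s z := by
  obtain ⟨z, hz⟩ := 𝓣.exists_torusDeriv_perm hs x
  refine ⟨z, ?_⟩
  ext1 v
  simp [M, hz]

theorem continuous_M : Continuous (𝓣.M hs) := by
  have := (𝓣.isDiffeo_perm hs).1.continuous_torusDeriv
  unfold M
  fun_prop

/-- The noncentral rows of the derivative are those of `A`. All the block identities needed for the
graph transforms follow from this. -/
theorem P_mul_M (x : Torus n) {j : Fin 3} (hj : j ≠ 1) :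
    𝓣.P j * 𝓣.M hs x = diag 𝓣.ν * 𝓣.P j := by
  obtain ⟨z, hz⟩ := 𝓣.exists_M_eq hs x
  ext v i
  simp only [clm_mul_apply, SpectralData.P_apply, diag_apply, hz]
  split_ifs with h
  · rw [𝓣.locDeriv_apply_of_ne s z v (by rw [h]; exact hj)]
  · simp

theorem isUnit_M (x : Torus n) : IsUnit (𝓣.M hs x) := by
  obtain ⟨z, hz⟩ := 𝓣.exists_M_eq hs x
  rw [hz, ← 𝓣.coe_locEquiv hs z]
  exact ⟨ContinuousLinearEquiv.toUnit (𝓣.locEquiv hs z), rfl⟩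

/-- The inverse of the derivative. -/
def Minv (x : Torus n) : EuclideanSpace ℝ ι →L[ℝ] EuclideanSpace ℝ ι := Ring.inverse (𝓣.M hs x)

theorem M_mul_Minv (x : Torus n) : 𝓣.M hs x * 𝓣.Minv hs x = 1 :=
  Ring.mul_inverse_cancel _ (𝓣.isUnit_M hs x)

theorem Minv_mul_M (x : Torus n) : 𝓣.Minv hs x * 𝓣.M hs x = 1 :=
  Ring.inverse_mul_cancel _ (𝓣.isUnit_M hs x)

theorem continuous_Minv : Continuous (𝓣.Minv hs) := by
  rw [continuous_iff_continuousAt]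
  intro x
  obtain ⟨u, hu⟩ := 𝓣.isUnit_M hs x
  have h1 : ContinuousAt Ring.inverse (𝓣.M hs x) := by
    rw [← hu]; exact NormedRing.inverse_continuousAt u
  exact ContinuousAt.comp (f := 𝓣.M hs) h1 (𝓣.continuous_M hs).continuousAt

theorem center_M (x : Torus n) : 𝓣.P 1 * (𝓣.M hs x * 𝓣.P 1) = 𝓣.M hs x * 𝓣.P 1 := by
  have h0 : 𝓣.P 0 * (𝓣.M hs x * 𝓣.P 1) = 0 := by
    rw [← mul_assoc, P_mul_M _ _ _ (by decide), mul_assoc, 𝓣.P_mul_of_ne (by decide), mul_zero]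
  have h2 : 𝓣.P 2 * (𝓣.M hs x * 𝓣.P 1) = 0 := by
    rw [← mul_assoc, P_mul_M _ _ _ (by decide), mul_assoc, 𝓣.P_mul_of_ne (by decide), mul_zero]
  calc 𝓣.P 1 * (𝓣.M hs x * 𝓣.P 1) = (𝓣.P 0 + 𝓣.P 1 + 𝓣.P 2) * (𝓣.M hs x * 𝓣.P 1) := by
        rw [add_mul, add_mul, h0, h2, zero_add, add_zero]
    _ = _ := by rw [𝓣.sum_P, one_mul]

theorem center_Minv (x : Torus n) :
    𝓣.P 1 * (𝓣.Minv hs x * 𝓣.P 1) = 𝓣.Minv hs x * 𝓣.P 1 := by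
  have key : ∀ j : Fin 3, j ≠ 1 → 𝓣.P j * (𝓣.Minv hs x * 𝓣.P 1) = 0 := fun j hj => by
    have h1 : diag 𝓣.ν * (𝓣.P j * (𝓣.Minv hs x * 𝓣.P 1)) = 0 := by
      rw [← mul_assoc, ← P_mul_M 𝓣 hs x hj, mul_assoc, ← mul_assoc (𝓣.M hs x), M_mul_Minv, one_mul,
        𝓣.P_mul_of_ne hj]
    have h2 := congrArg (diag (fun i => (𝓣.ν i)⁻¹) * ·) h1
    simpa only [← mul_assoc, 𝓣.diag_inv_mul_diag, one_mul, mul_zero] using h2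
  calc 𝓣.P 1 * (𝓣.Minv hs x * 𝓣.P 1)
      = (𝓣.P 0 + 𝓣.P 1 + 𝓣.P 2) * (𝓣.Minv hs x * 𝓣.P 1) := by
        rw [add_mul, add_mul, key 0 (by decide), key 2 (by decide), zero_add, add_zero]
    _ = _ := by rw [𝓣.sum_P, one_mul]

/-- The derivative on the sum of the centre and another bundle. -/
theorem M_mul_P (x : Torus n) {j : Fin 3} (hj : j ≠ 1) :
    𝓣.M hs x * 𝓣.P j = diag 𝓣.ν * 𝓣.P j + 𝓣.P 1 * (𝓣.M hs x * 𝓣.P j) := by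
  have key : ∀ k : Fin 3, k ≠ 1 → 𝓣.P k * (𝓣.M hs x * 𝓣.P j) = diag 𝓣.ν * (𝓣.P k * 𝓣.P j) :=
    fun k hk => by rw [← mul_assoc, P_mul_M _ _ _ hk, mul_assoc]
  have hj' : ∀ k : Fin 3, k ≠ 1 → k = 0 ∨ k = 2 := by decide
  calc 𝓣.M hs x * 𝓣.P j = (𝓣.P 0 + 𝓣.P 1 + 𝓣.P 2) * (𝓣.M hs x * 𝓣.P j) := by
        rw [𝓣.sum_P, one_mul]
    _ = diag 𝓣.ν * (𝓣.P 0 * 𝓣.P j) + 𝓣.P 1 * (𝓣.M hs x * 𝓣.P j) +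
        diag 𝓣.ν * (𝓣.P 2 * 𝓣.P j) := by
        rw [add_mul, add_mul, key 0 (by decide), key 2 (by decide)]
    _ = _ := by
        rcases hj' j hj with rfl | rfl
        · rw [𝓣.P_mul_self, 𝓣.P_mul_of_ne (j := 2) (by decide), mul_zero, add_zero]
        · rw [𝓣.P_mul_self, 𝓣.P_mul_of_ne (j := 0) (by decide), mul_zero, zero_add, add_comm]

theorem norm_M_center_le (x : Torus n) {v : EuclideanSpace ℝ ι} (hv : 𝓣.P 1 v = v) :
    ‖𝓣.M hs x v‖ ≤ (𝓣.β' + 𝓣.margin) * ‖v‖ := by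
  obtain ⟨z, hz⟩ := 𝓣.exists_M_eq hs x
  rw [hz]
  exact 𝓣.norm_locDeriv_le hs z (𝓣.P_apply_eq_self_iff.1 hv)

theorem le_norm_M_center (x : Torus n) {v : EuclideanSpace ℝ ι} (hv : 𝓣.P 1 v = v) :
    (𝓣.β - 𝓣.margin) * ‖v‖ ≤ ‖𝓣.M hs x v‖ := by
  obtain ⟨z, hz⟩ := 𝓣.exists_M_eq hs x
  rw [hz]
  exact 𝓣.le_norm_locDeriv hs z (𝓣.P_apply_eq_self_iff.1 hv)

/-- `L` describes invariant graphs over the coordinate space `j`, with values in the centre. -/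
structure IsInvariantGraph (j : Fin 3)
    (L : C(Torus n, EuclideanSpace ℝ ι →L[ℝ] EuclideanSpace ℝ ι)) : Prop where
  center_mul : ∀ x, 𝓣.P 1 * L x = L x
  mul_base : ∀ x, L x * 𝓣.P j = L x
  invariant : ∀ x, 𝓣.M hs x * (𝓣.P j + L x) = (𝓣.P j + L (𝓣.perm hs x)) * diag 𝓣.ν

/-- The forward graph transform expands by at most `β' + margin` in the centre and contracts by
`κ⁻¹` in the base, so its ratio `(β' + margin) / κ` is below `1`. The graph at `y` is computed from
the one at the preimage of `y`. -/
theorem exists_unstable_graph : ∃ L, 𝓣.IsInvariantGraph hs 2 L := by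
  have hM := 𝓣.continuous_M hs
  have hf := (𝓣.isDiffeo_perm hs).2.continuous
  have hm := 𝓣.margin_pos
  have hm' := 𝓣.margin_le'
  have hb := 𝓣.β'_pos
  have hκ : 0 < 𝓣.κ := hb.trans 𝓣.β'_lt
  set J := diag (fun i => (𝓣.ν i)⁻¹) * 𝓣.P 2 with hJ
  have hJnorm : ‖J‖ ≤ 𝓣.κ⁻¹ := by
    refine ContinuousLinearMap.opNorm_le_bound _ (by positivity) fun v => ?_
    rw [hJ, clm_mul_apply]
    refine (norm_diag_le (C := 𝓣.κ⁻¹) (by positivity) fun i hi => ?_).trans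
      (by gcongr; exact 𝓣.norm_P_apply_le 2 v)
    have h2 : 𝓣.τ i = 2 := by
      by_contra h
      exact hi (by rw [SpectralData.P_apply, if_neg h])
    rw [abs_inv]
    exact inv_anti₀ hκ (𝓣.unstable i h2)
  obtain ⟨L, hL⟩ := exists_continuous_fixedSection
    (U := ⟨fun y => 𝓣.P 1 * 𝓣.M hs ((𝓣.perm hs).symm y) * J, by fun_prop⟩)
    (V := ⟨fun y => 𝓣.M hs ((𝓣.perm hs).symm y) * 𝓣.P 1, by fun_prop⟩)
    (τ := ⟨(𝓣.perm hs).symm, hf⟩) (W := J) (q := (𝓣.β' + 𝓣.margin) * 𝓣.κ⁻¹)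
    (by positivity) (by rw [← div_eq_mul_inv, div_lt_one hκ]; linarith)
    (fun y => by
      refine mul_le_mul ?_ hJnorm (norm_nonneg _) (by positivity)
      refine ContinuousLinearMap.opNorm_le_bound _ (by positivity) fun v => ?_
      refine (𝓣.norm_M_center_le hs _ (v := 𝓣.P 1 v) ?_).trans
        (by gcongr; exact 𝓣.norm_P_apply_le 1 v)
      exact congrArg (fun B : EuclideanSpace ℝ ι →L[ℝ] EuclideanSpace ℝ ι => B v) (𝓣.P_mul_self 1))
  simp only [ContinuousMap.coe_mk] at hL
  have h := fun y => unstable_graph_properties (𝓣.P_mul_self 2) (𝓣.P_mul_self 1)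
    (𝓣.center_M hs _) (hL y)
  refine ⟨L, fun y => (h y).1, fun y => (h y).2, fun x => ?_⟩
  have e := hL (𝓣.perm hs x)
  rw [Equiv.symm_apply_apply] at e
  exact unstable_graph_invariant (𝓣.P_mul_diag 2 _) 𝓣.diag_inv_mul_diag
    (𝓣.M_mul_P hs x (by decide)) (h x).1 (h x).2 e

/-- The backward graph transform has ratio `α / (β - margin) < 1`: the inverse derivative costs at
most `(β - margin)⁻¹` on the centre, and `A` contracts the base by `α`. -/
theorem exists_stable_graph : ∃ L, 𝓣.IsInvariantGraph hs 0 L := by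
  have hM := 𝓣.continuous_M hs
  have hMi := 𝓣.continuous_Minv hs
  have hf := (𝓣.isDiffeo_perm hs).1.continuous
  have hm := 𝓣.margin_pos
  have hm' := 𝓣.margin_le
  have hα := 𝓣.α_nonneg
  have hβ : 0 < 𝓣.β - 𝓣.margin := by linarith [𝓣.margin_lt]
  set J := diag 𝓣.ν * 𝓣.P 0 with hJ
  have hJnorm : ‖J‖ ≤ 𝓣.α := by
    refine ContinuousLinearMap.opNorm_le_bound _ (by positivity) fun v => ?_
    rw [hJ, clm_mul_apply]
    refine (norm_diag_le hα fun i hi => ?_).trans (by gcongr; exact 𝓣.norm_P_apply_le 0 v)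
    have h2 : 𝓣.τ i = 0 := by
      by_contra h
      exact hi (by rw [SpectralData.P_apply, if_neg h])
    exact 𝓣.stable i h2
  have hC : ∀ x, ‖𝓣.Minv hs x * 𝓣.P 1‖ ≤ (𝓣.β - 𝓣.margin)⁻¹ := fun x => by
    refine ContinuousLinearMap.opNorm_le_bound _ (by positivity) fun v => ?_
    have h1 := 𝓣.le_norm_M_center hs x (v := (𝓣.Minv hs x * 𝓣.P 1) v)
      (congrArg (fun B : EuclideanSpace ℝ ι →L[ℝ] EuclideanSpace ℝ ι => B v) (𝓣.center_Minv hs x))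
    have h2 : 𝓣.M hs x ((𝓣.Minv hs x * 𝓣.P 1) v) = 𝓣.P 1 v := by
      have := congrArg (fun B : EuclideanSpace ℝ ι →L[ℝ] EuclideanSpace ℝ ι => B (𝓣.P 1 v))
        (𝓣.M_mul_Minv hs x)
      exact this
    rw [h2] at h1
    rw [inv_mul_eq_div, le_div_iff₀' hβ]
    exact h1.trans (𝓣.norm_P_apply_le 1 v)
  obtain ⟨L, hL⟩ := exists_continuous_fixedSection
    (U := ⟨fun y => -(𝓣.Minv hs y * 𝓣.P 1 * 𝓣.M hs y * 𝓣.P 0), by fun_prop⟩)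
    (V := ⟨fun y => 𝓣.Minv hs y * 𝓣.P 1, by fun_prop⟩)
    (τ := ⟨𝓣.perm hs, hf⟩) (W := J) (q := (𝓣.β - 𝓣.margin)⁻¹ * 𝓣.α)
    (by positivity) (by rw [inv_mul_eq_div, div_lt_one hβ]; linarith)
    (fun y => mul_le_mul (hC y) hJnorm (norm_nonneg _) (by positivity))
  simp only [ContinuousMap.coe_mk] at hL
  have h := fun y => stable_graph_properties (𝓣.P_mul_self 0) (𝓣.center_Minv hs _) (hL y)
  exact ⟨L, fun y => (h y).1, fun y => (h y).2, fun x =>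
    stable_graph_invariant (𝓣.P_mul_diag 0 _) (𝓣.M_mul_Minv hs x)
      (𝓣.M_mul_P hs x (by decide)) (h _).1 (h _).2 (hL x)⟩

end ToralModel

/-- The constant Riemannian metric induced by an injective linear map. -/
def constMetric {n : ℕ} {X : Type*} [NormedAddCommGroup X] [InnerProductSpace ℝ X]
    (B : E n →L[ℝ] X) (hB : Function.Injective B) : RiemMetric n where
  inner _ := (innerSL ℝ (E := X)).bilinearComp B B
  symm _ v w := by simp [real_inner_comm]
  pos _ v hv := by
    have : B v ≠ 0 := fun h => hv (hB (by rw [h, map_zero]))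
    simpa using pow_pos (norm_pos_iff.2 this) 2
  smooth := contDiff_const

theorem constMetric_norm {n : ℕ} {X : Type*} [NormedAddCommGroup X] [InnerProductSpace ℝ X]
    (B : E n →L[ℝ] X) (hB : Function.Injective B) (x : Torus n) (v : E n) :
    (constMetric B hB).norm x v = ‖B v‖ := by
  change Real.sqrt (inner ℝ (B v) (B v)) = _
  rw [real_inner_self_eq_norm_sq, Real.sqrt_sq (norm_nonneg _)]

/-! ### Rescaling the centre for an adapted metric. -/

namespace SpectralData

variable {ι : Type*} [Fintype ι] (S : SpectralData ι)

/-- The operator which scales the central coordinates by `c`. -/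
def centerScale (c : ℝ) : EuclideanSpace ℝ ι →L[ℝ] EuclideanSpace ℝ ι :=
  diag fun i => if S.τ i = 1 then c else 1

theorem centerScale_of_center (c : ℝ) {v : EuclideanSpace ℝ ι} (hv : S.P 1 v = v) :
    S.centerScale c v = c • v := by
  rw [P_apply_eq_self_iff] at hv
  ext i
  by_cases h : S.τ i = 1
  · simp [centerScale, h]
  · simp [centerScale, hv i h]

theorem centerScale_of_base (c : ℝ) {j : Fin 3} (hj : j ≠ 1) {v : EuclideanSpace ℝ ι}
    (hv : S.P j v = v) : S.centerScale c v = v := by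
  rw [P_apply_eq_self_iff] at hv
  ext i
  by_cases h : S.τ i = 1
  · simp [centerScale, hv i (by rw [h]; exact hj.symm)]
  · simp [centerScale, h]

theorem centerScale_injective {c : ℝ} (hc : 0 < c) : Function.Injective (S.centerScale c) := by
  rw [injective_iff_map_eq_zero]
  intro v hv
  ext i
  have := congrArg (fun w : EuclideanSpace ℝ ι => w i) hv
  simp only [centerScale, diag_apply, PiLp.zero_apply, mul_eq_zero] at this
  rcases this with h | h
  · split_ifs at h
    · exact absurd h hc.ne'
    · exact absurd h one_ne_zero
  · simpa using h

theorem le_norm_centerScale (c : ℝ) {j : Fin 3} (hj : j ≠ 1) (v : EuclideanSpace ℝ ι) :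
    ‖S.P j v‖ ≤ ‖S.centerScale c v‖ := by
  have : S.P j (S.centerScale c v) = S.P j v := by
    rw [← clm_mul_apply, centerScale, P_mul_diag, clm_mul_apply]
    exact S.centerScale_of_base c hj (by rw [← clm_mul_apply, P_mul_self])
  rw [← this]
  exact S.norm_P_apply_le j _

end SpectralData

/-! ### Dimensions, splitting and rates of the perturbed bundles. -/

namespace ToralModel

variable {n : ℕ} {A : Matrix.SpecialLinearGroup (Fin n) ℤ} {ι : Type*} [Fintype ι]
  (𝓣 : ToralModel A ι) {s : ℝ} {hs : s ∈ Set.Icc (0 : ℝ) 1}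

namespace IsInvariantGraph

variable {𝓣} {j : Fin 3} {L : C(Torus n, EuclideanSpace ℝ ι →L[ℝ] EuclideanSpace ℝ ι)}

theorem idempotent (h : 𝓣.IsInvariantGraph hs j L) (hj : j ≠ 1) (x : Torus n) :
    (𝓣.P j + L x) * (𝓣.P j + L x) = 𝓣.P j + L x :=
  graph_mul_self (𝓣.P_mul_self j) (𝓣.P_mul_of_ne hj) (h.center_mul x) (h.mul_base x)

theorem finrank_eq (h : 𝓣.IsInvariantGraph hs j L) (hj : j ≠ 1) (x : Torus n) :
    Module.finrank ℝ (fixedSpace 𝓣.T (𝓣.P j + L x)) =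
      Module.finrank ℝ (fixedSpace 𝓣.T (𝓣.P j)) :=
  le_antisymm
    (finrank_fixedSpace_le _ (𝓣.P_mul_self j) (graph_mul_base (𝓣.P_mul_self j) (h.mul_base x)))
    (finrank_fixedSpace_le _ (h.idempotent hj x)
      (base_mul_graph (𝓣.P_mul_self j) (𝓣.P_mul_of_ne hj) (h.center_mul x)))

theorem map_eq (h : 𝓣.IsInvariantGraph hs j L) (hj : j ≠ 1) (x : Torus n) :
    (fixedSpace 𝓣.T (𝓣.P j + L x)).map (torusDeriv (𝓣.perm hs) x : E n →ₗ[ℝ] E n) =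
      fixedSpace 𝓣.T (𝓣.P j + L (𝓣.perm hs x)) := by
  rw [torusDeriv_eq]
  refine map_fixedSpace _ (𝓣.M_mul_Minv hs x) ?_ ?_
  · rw [h.invariant, ← mul_assoc, h.idempotent hj]
  · have e : 𝓣.Minv hs x * (𝓣.P j + L (𝓣.perm hs x)) =
        (𝓣.P j + L x) * diag (fun i => (𝓣.ν i)⁻¹) := by
      calc _ = 𝓣.Minv hs x * ((𝓣.P j + L (𝓣.perm hs x)) * diag 𝓣.ν) *
            diag (fun i => (𝓣.ν i)⁻¹) := by
            rw [mul_assoc, mul_assoc, 𝓣.diag_mul_diag_inv, mul_one]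
        _ = _ := by rw [← h.invariant, ← mul_assoc, 𝓣.Minv_mul_M, one_mul]
    rw [e, ← mul_assoc, h.idempotent hj]

/-- A vector of the invariant bundle, its base component, and its image. -/
theorem apply_eq (h : 𝓣.IsInvariantGraph hs j L) (x : Torus n)
    {y : EuclideanSpace ℝ ι} (hy : (𝓣.P j + L x) y = y) :
    y = 𝓣.P j y + L x (𝓣.P j y) ∧
      𝓣.M hs x y = diag 𝓣.ν (𝓣.P j y) + L (𝓣.perm hs x) (diag 𝓣.ν (𝓣.P j y)) := by
  have h1 : ∀ x y, L x y = L x (𝓣.P j y) := fun x y => by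
    rw [← clm_mul_apply, h.mul_base]
  refine ⟨?_, ?_⟩
  · rw [← h1]
    exact hy.symm
  · conv_lhs => rw [← hy, ← clm_mul_apply, h.invariant, clm_mul_apply]
    rw [add_apply, h1, ← clm_mul_apply (𝓣.P j), 𝓣.P_mul_diag, clm_mul_apply]

theorem norm_centerScale_le (h : 𝓣.IsInvariantGraph hs j L) (hj : j ≠ 1) {c B : ℝ} (hc : 0 < c)
    (hB : ∀ x, ‖L x‖ ≤ B) (x : Torus n) {a : EuclideanSpace ℝ ι} (ha : 𝓣.P j a = a) :
    ‖𝓣.centerScale c (a + L x a)‖ ≤ (1 + c * B) * ‖a‖ := by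
  have h1 : 𝓣.P 1 (L x a) = L x a := by rw [← clm_mul_apply, h.center_mul]
  rw [map_add, 𝓣.centerScale_of_base c hj ha, 𝓣.centerScale_of_center c h1]
  calc ‖a + c • L x a‖ ≤ ‖a‖ + ‖c • L x a‖ := norm_add_le _ _
    _ ≤ ‖a‖ + c * (B * ‖a‖) := by
        rw [norm_smul, Real.norm_eq_abs, abs_of_pos hc]
        gcongr
        exact (L x).le_of_opNorm_le (hB x) a
    _ = _ := by ring

theorem base_ne_zero (h : 𝓣.IsInvariantGraph hs j L) (x : Torus n) {y : EuclideanSpace ℝ ι}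
    (hy : (𝓣.P j + L x) y = y) (hy0 : y ≠ 0) : 0 < ‖𝓣.P j y‖ := by
  rw [norm_pos_iff]
  intro h0
  have := (h.apply_eq x hy).1
  rw [h0, map_zero, add_zero] at this
  exact hy0 this

end IsInvariantGraph

theorem isInternal_graphs {Ls Lu : C(Torus n, EuclideanSpace ℝ ι →L[ℝ] EuclideanSpace ℝ ι)}
    (hLs : 𝓣.IsInvariantGraph hs 0 Ls) (hLu : 𝓣.IsInvariantGraph hs 2 Lu) (x : Torus n) :
    DirectSum.IsInternal ![fixedSpace 𝓣.T (𝓣.P 0 + Ls x), fixedSpace 𝓣.T (𝓣.P 1),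
      fixedSpace 𝓣.T (𝓣.P 2 + Lu x)] := by
  have h02 := graph_mul_graph (𝓣.P_mul_of_ne (show (0 : Fin 3) ≠ 2 by decide))
    (𝓣.P_mul_of_ne (show (0 : Fin 3) ≠ 1 by decide)) (hLs.mul_base x) (hLu.center_mul x)
  have h20 := graph_mul_graph (𝓣.P_mul_of_ne (show (2 : Fin 3) ≠ 0 by decide))
    (𝓣.P_mul_of_ne (show (2 : Fin 3) ≠ 1 by decide)) (hLu.mul_base x) (hLs.center_mul x)
  have h01 := graph_mul_center (𝓣.P_mul_of_ne (show (0 : Fin 3) ≠ 1 by decide)) (hLs.mul_base x)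
  have h21 := graph_mul_center (𝓣.P_mul_of_ne (show (2 : Fin 3) ≠ 1 by decide)) (hLu.mul_base x)
  have h00 := hLs.idempotent (by decide) x
  have h22 := hLu.idempotent (by decide) x
  have hsum := 𝓣.sum_P
  have h1s := hLs.center_mul x
  have h1u := hLu.center_mul x
  set Qs := 𝓣.P 0 + Ls x with hQs
  set Qu := 𝓣.P 2 + Lu x with hQu
  have hc : ∀ y, 𝓣.P 1 (y - Qs y - Qu y) = y - Qs y - Qu y := fun y => by
    have e1 : y - Qs y - Qu y = 𝓣.P 1 y - Ls x y - Lu x y := by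
      have : y = 𝓣.P 0 y + 𝓣.P 1 y + 𝓣.P 2 y :=
        (congrArg (fun B : EuclideanSpace ℝ ι →L[ℝ] EuclideanSpace ℝ ι => B y) hsum).symm
      nth_rw 1 [this]
      rw [hQs, hQu, add_apply, add_apply]
      abel
    rw [e1, map_sub, map_sub, ← clm_mul_apply, ← clm_mul_apply, ← clm_mul_apply, 𝓣.P_mul_self,
      h1s, h1u]
  have app : ∀ {B C D : EuclideanSpace ℝ ι →L[ℝ] EuclideanSpace ℝ ι}, B * C = D →
      ∀ y, B (C y) = D y := fun h y => by rw [← h, clm_mul_apply]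
  let q : Fin 3 → E n →ₗ[ℝ] E n :=
    ![(((𝓣.T.symm : EuclideanSpace ℝ ι →L[ℝ] E n).comp Qs).comp
        (𝓣.T : E n →L[ℝ] EuclideanSpace ℝ ι) : E n →L[ℝ] E n),
      (((𝓣.T.symm : EuclideanSpace ℝ ι →L[ℝ] E n).comp (1 - Qs - Qu)).comp
        (𝓣.T : E n →L[ℝ] EuclideanSpace ℝ ι) : E n →L[ℝ] E n),
      (((𝓣.T.symm : EuclideanSpace ℝ ι →L[ℝ] E n).comp Qu).comp
        (𝓣.T : E n →L[ℝ] EuclideanSpace ℝ ι) : E n →L[ℝ] E n)]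
  have q0 : ∀ v, q 0 v = 𝓣.T.symm (Qs (𝓣.T v)) := fun v => rfl
  have q1 : ∀ v, q 1 v = 𝓣.T.symm (𝓣.T v - Qs (𝓣.T v) - Qu (𝓣.T v)) := fun v => rfl
  have q2 : ∀ v, q 2 v = 𝓣.T.symm (Qu (𝓣.T v)) := fun v => rfl
  refine isInternal_of_projections _ q ?_ ?_ ?_ ?_
  · intro i v
    fin_cases i
    · exact (symm_mem_fixedSpace _).2 (app h00 _)
    · exact (symm_mem_fixedSpace _).2 (hc _)
    · exact (symm_mem_fixedSpace _).2 (app h22 _)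
  · intro v
    rw [Fin.sum_univ_three, q0, q1, q2, ← map_add, ← map_add]
    rw [ContinuousLinearEquiv.symm_apply_eq]
    abel
  · intro i v hv
    fin_cases i
    · have hv : Qs (𝓣.T v) = 𝓣.T v := (mem_fixedSpace _).1 hv
      change q 0 v = v
      rw [q0, hv, ContinuousLinearEquiv.symm_apply_apply]
    · have hv : 𝓣.P 1 (𝓣.T v) = 𝓣.T v := (mem_fixedSpace _).1 hv
      change q 1 v = v
      have e0 := app h01 (𝓣.T v)
      have e2 := app h21 (𝓣.T v)
      rw [hv] at e0 e2
      rw [q1, e0, e2]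
      simp
    · have hv : Qu (𝓣.T v) = 𝓣.T v := (mem_fixedSpace _).1 hv
      change q 2 v = v
      rw [q2, hv, ContinuousLinearEquiv.symm_apply_apply]
  · intro i j hij v hv
    have hs0 : v ∈ fixedSpace 𝓣.T Qs → Qs (𝓣.T v) = 𝓣.T v ∧ Qu (𝓣.T v) = 0 := fun hv => by
      have hv := (mem_fixedSpace _).1 hv
      have e := app h20 (𝓣.T v)
      rw [hv] at e
      exact ⟨hv, e⟩
    have hs1 : v ∈ fixedSpace 𝓣.T (𝓣.P 1) → Qs (𝓣.T v) = 0 ∧ Qu (𝓣.T v) = 0 := fun hv => by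
      have hv := (mem_fixedSpace _).1 hv
      have e := app h21 (𝓣.T v)
      have e' := app h01 (𝓣.T v)
      rw [hv] at e e'
      exact ⟨e', e⟩
    have hs2 : v ∈ fixedSpace 𝓣.T Qu → Qs (𝓣.T v) = 0 ∧ Qu (𝓣.T v) = 𝓣.T v := fun hv => by
      have hv := (mem_fixedSpace _).1 hv
      have e := app h02 (𝓣.T v)
      rw [hv] at e
      exact ⟨e, hv⟩
    fin_cases i <;> fin_cases j
    · exact absurd rfl hij
    · change q 0 v = 0
      rw [q0, (hs1 hv).1, map_zero]
    · change q 0 v = 0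
      rw [q0, (hs2 hv).1, map_zero]
    · change q 1 v = 0
      rw [q1, (hs0 hv).1, (hs0 hv).2, sub_self, sub_zero, map_zero]
    · exact absurd rfl hij
    · change q 1 v = 0
      rw [q1, (hs2 hv).1, (hs2 hv).2, sub_zero, sub_self, map_zero]
    · change q 2 v = 0
      rw [q2, (hs0 hv).2, map_zero]
    · change q 2 v = 0
      rw [q2, (hs1 hv).2, map_zero]
    · exact absurd rfl hij

/-- A vector of a strong bundle is `a + L a` with `a` in the linear bundle, and its base evolves by
`A`. After rescaling, its length lies between `‖a‖` and `(1 + e) ‖a‖`, so the strong rates are those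
of `A` up to the factor `1 + e`. -/
theorem exists_rates {Ls Lu : C(Torus n, EuclideanSpace ℝ ι →L[ℝ] EuclideanSpace ℝ ι)}
    (hLs : 𝓣.IsInvariantGraph hs 0 Ls) (hLu : 𝓣.IsInvariantGraph hs 2 Lu) :
    ∃ (g : RiemMetric n) (ls lc lc' lu : ℝ), ls < 1 ∧ 1 < lu ∧ ls < lc ∧ lc < lc' ∧ lc' < lu ∧
      ∀ x v, v ≠ 0 →
        (v ∈ fixedSpace 𝓣.T (𝓣.P 0 + Ls x) →
          g.norm (𝓣.perm hs x) (torusDeriv (𝓣.perm hs) x v) < ls * g.norm x v) ∧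
        (v ∈ fixedSpace 𝓣.T (𝓣.P 1) →
          lc * g.norm x v < g.norm (𝓣.perm hs x) (torusDeriv (𝓣.perm hs) x v) ∧
          g.norm (𝓣.perm hs x) (torusDeriv (𝓣.perm hs) x v) < lc' * g.norm x v) ∧
        (v ∈ fixedSpace 𝓣.T (𝓣.P 2 + Lu x) →
          lu * g.norm x v < g.norm (𝓣.perm hs x) (torusDeriv (𝓣.perm hs) x v)) := by
  have hm := 𝓣.margin_pos
  have hm1 := 𝓣.margin_le
  have hm2 := 𝓣.margin_le'
  have hα := 𝓣.α_nonneg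
  have hβ := 𝓣.β_lt
  have hβ' := 𝓣.lt_β'
  have hκ : 1 < 𝓣.κ := hβ'.trans 𝓣.β'_lt
  -- A number below `κ` multiplied by `1 + e` grows by at most `margin / 2`, less than the room left
  -- between consecutive rates.
  set e : ℝ := 𝓣.margin / (2 * 𝓣.κ) with he
  have he0 : 0 < e := by positivity
  have heκ : e * 𝓣.κ = 𝓣.margin / 2 := by rw [he]; field_simp
  -- the central directions are scaled down so that the graphs become almost flat
  obtain ⟨Bs, hBs⟩ := isCompact_univ.exists_bound_of_continuousOn Ls.continuous.continuousOn
  obtain ⟨Bu, hBu⟩ := isCompact_univ.exists_bound_of_continuousOn Lu.continuous.continuousOn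
  set B : ℝ := max Bs Bu with hB
  replace hBs : ∀ x, ‖Ls x‖ ≤ B := fun x => (hBs x trivial).trans (le_max_left _ _)
  replace hBu : ∀ x, ‖Lu x‖ ≤ B := fun x => (hBu x trivial).trans (le_max_right _ _)
  have hB0 : 0 ≤ B := (norm_nonneg _).trans (hBs 0)
  set c : ℝ := e / (B + 1) with hcdef
  have hc : 0 < c := by positivity
  have hcB : c * B ≤ e := by
    rw [hcdef, div_mul_eq_mul_div, div_le_iff₀ (by positivity)]
    nlinarith
  have hinj : Function.Injective
      ((𝓣.centerScale c).comp (𝓣.T : E n →L[ℝ] EuclideanSpace ℝ ι)) :=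
    (𝓣.centerScale_injective hc).comp 𝓣.T.injective
  -- The central estimates hold with one `margin`; a second makes them strict, and a third separates
  -- the strong rates. The gaps `β - α` and `κ - β'` contain four.
  refine ⟨constMetric _ hinj, 𝓣.β - 3 * 𝓣.margin, 𝓣.β - 2 * 𝓣.margin, 𝓣.β' + 2 * 𝓣.margin,
    𝓣.β' + 3 * 𝓣.margin, by linarith, by linarith, by linarith, by linarith, by linarith, ?_⟩
  intro x v hv
  have hTv : 𝓣.T v ≠ 0 := by simpa using hv
  have hD : ((𝓣.centerScale c).comp (𝓣.T : E n →L[ℝ] EuclideanSpace ℝ ι))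
      (torusDeriv (𝓣.perm hs) x v) = 𝓣.centerScale c (𝓣.M hs x (𝓣.T v)) := by
    rw [torusDeriv_eq]; simp
  have hV : ((𝓣.centerScale c).comp (𝓣.T : E n →L[ℝ] EuclideanSpace ℝ ι)) v =
      𝓣.centerScale c (𝓣.T v) := rfl
  rw [constMetric_norm, constMetric_norm, hD, hV]
  have hνP : ∀ (j : Fin 3) (y : EuclideanSpace ℝ ι),
      𝓣.P j (diag 𝓣.ν (𝓣.P j y)) = diag 𝓣.ν (𝓣.P j y) := fun j y => by
    rw [← clm_mul_apply (𝓣.P j), 𝓣.P_mul_diag, clm_mul_apply, ← clm_mul_apply (𝓣.P j),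
      𝓣.P_mul_self]
  have hτ : ∀ (j : Fin 3) (y : EuclideanSpace ℝ ι) (i : ι), 𝓣.P j y i ≠ 0 → 𝓣.τ i = j :=
    fun j y i hi => by
      by_contra h
      exact hi (by rw [SpectralData.P_apply, if_neg h])
  refine ⟨fun hvs => ?_, fun hvc => ?_, fun hvu => ?_⟩
  · rw [mem_fixedSpace] at hvs
    have h0 := hLs.base_ne_zero x hvs hTv
    obtain ⟨-, h2⟩ := hLs.apply_eq x hvs
    have h3 := 𝓣.le_norm_centerScale c (show (0 : Fin 3) ≠ 1 by decide) (𝓣.T v)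
    have h4 := hLs.norm_centerScale_le (by decide) hc hBs (𝓣.perm hs x) (hνP 0 (𝓣.T v))
    rw [← h2] at h4
    have h5 : ‖diag 𝓣.ν (𝓣.P 0 (𝓣.T v))‖ ≤ 𝓣.α * ‖𝓣.P 0 (𝓣.T v)‖ :=
      norm_diag_le hα fun i hi => 𝓣.stable i (hτ 0 _ i hi)
    calc _ ≤ (1 + c * B) * ‖diag 𝓣.ν (𝓣.P 0 (𝓣.T v))‖ := h4
      _ ≤ (1 + e) * (𝓣.α * ‖𝓣.P 0 (𝓣.T v)‖) := by gcongr
      _ = (𝓣.α + e * 𝓣.α) * ‖𝓣.P 0 (𝓣.T v)‖ := by ring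
      _ < (𝓣.β - 3 * 𝓣.margin) * ‖𝓣.P 0 (𝓣.T v)‖ := by
          gcongr
          have : e * 𝓣.α ≤ e * 𝓣.κ := by gcongr; linarith
          linarith
      _ ≤ _ := by
          gcongr
          linarith
  · rw [mem_fixedSpace] at hvc
    have h1 : 𝓣.P 1 (𝓣.M hs x (𝓣.T v)) = 𝓣.M hs x (𝓣.T v) := by
      conv_rhs => rw [← hvc]
      conv_lhs => rw [← hvc]
      exact congrArg (fun B : EuclideanSpace ℝ ι →L[ℝ] EuclideanSpace ℝ ι => B (𝓣.T v))
        (𝓣.center_M hs x)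
    rw [𝓣.centerScale_of_center c hvc, 𝓣.centerScale_of_center c h1, norm_smul, norm_smul,
      Real.norm_eq_abs, abs_of_pos hc]
    have h2 := 𝓣.norm_M_center_le hs x hvc
    have h3 := 𝓣.le_norm_M_center hs x hvc
    have h4 : 0 < ‖𝓣.T v‖ := norm_pos_iff.2 hTv
    have h5 : 0 < 𝓣.margin * ‖𝓣.T v‖ := by positivity
    constructor
    · rw [mul_left_comm]
      gcongr
      linarith
    · rw [mul_left_comm]
      gcongr
      linarith
  · rw [mem_fixedSpace] at hvu
    have h0 := hLu.base_ne_zero x hvu hTv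
    obtain ⟨h1, h2⟩ := hLu.apply_eq x hvu
    have h3 := 𝓣.le_norm_centerScale c (show (2 : Fin 3) ≠ 1 by decide) (𝓣.M hs x (𝓣.T v))
    have h4 := hLu.norm_centerScale_le (by decide) hc hBu x (a := 𝓣.P 2 (𝓣.T v))
      (by rw [← clm_mul_apply, 𝓣.P_mul_self])
    rw [← h1] at h4
    have h5 : 𝓣.κ * ‖𝓣.P 2 (𝓣.T v)‖ ≤ ‖diag 𝓣.ν (𝓣.P 2 (𝓣.T v))‖ :=
      le_norm_diag (by linarith) fun i hi => 𝓣.unstable i (hτ 2 _ i hi)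
    have h6 : 𝓣.P 2 (𝓣.M hs x (𝓣.T v)) = diag 𝓣.ν (𝓣.P 2 (𝓣.T v)) := by
      rw [← clm_mul_apply, 𝓣.P_mul_M hs x (by decide), clm_mul_apply]
    rw [h6] at h3
    calc _ ≤ (𝓣.β' + 3 * 𝓣.margin) * ((1 + e) * ‖𝓣.P 2 (𝓣.T v)‖) := by
          gcongr
          exact h4.trans (by gcongr)
      _ = (𝓣.β' + 3 * 𝓣.margin + e * (𝓣.β' + 3 * 𝓣.margin)) * ‖𝓣.P 2 (𝓣.T v)‖ := by ring
      _ < 𝓣.κ * ‖𝓣.P 2 (𝓣.T v)‖ := by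
          gcongr
          have : e * (𝓣.β' + 3 * 𝓣.margin) ≤ e * 𝓣.κ := by gcongr; linarith
          linarith
      _ ≤ _ := h5.trans h3

theorem isSubbundle_graph {j : Fin 3}
    {L : C(Torus n, EuclideanSpace ℝ ι →L[ℝ] EuclideanSpace ℝ ι)}
    (hL : 𝓣.IsInvariantGraph hs j L) (hj : j ≠ 1) :
    IsSubbundle fun x => fixedSpace 𝓣.T (𝓣.P j + L x) := by
  have hc : Continuous fun x => 𝓣.P j + L x := by fun_prop
  exact ⟨⟨_, hL.finrank_eq hj⟩, isClosed_fixedSpace (Q := fun x => 𝓣.P j + L x) 𝓣.T hc⟩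

theorem isSubbundle_center : IsSubbundle fun _ : Torus n => fixedSpace 𝓣.T (𝓣.P 1) :=
  ⟨⟨_, fun _ => rfl⟩, isClosed_fixedSpace (Q := fun _ : Torus n => 𝓣.P 1) 𝓣.T continuous_const⟩

theorem graph_ne_bot {j : Fin 3} {L : C(Torus n, EuclideanSpace ℝ ι →L[ℝ] EuclideanSpace ℝ ι)}
    (hL : 𝓣.IsInvariantGraph hs j L) (hj : j ≠ 1) (hne : fixedSpace 𝓣.T (𝓣.P j) ≠ ⊥)
    (x : Torus n) : fixedSpace 𝓣.T (𝓣.P j + L x) ≠ ⊥ := by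
  rw [Ne, ← Submodule.finrank_eq_zero, hL.finrank_eq hj, Submodule.finrank_eq_zero]
  exact hne

theorem map_center (x : Torus n) :
    (fixedSpace 𝓣.T (𝓣.P 1)).map (torusDeriv (𝓣.perm hs) x : E n →ₗ[ℝ] E n) =
      fixedSpace 𝓣.T (𝓣.P 1) := by
  rw [torusDeriv_eq]
  exact map_fixedSpace _ (𝓣.M_mul_Minv hs x) (𝓣.center_M hs x) (𝓣.center_Minv hs x)

theorem isPartiallyHyperbolic {Ls Lu : C(Torus n, EuclideanSpace ℝ ι →L[ℝ] EuclideanSpace ℝ ι)}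
    (hLs : 𝓣.IsInvariantGraph hs 0 Ls) (hLu : 𝓣.IsInvariantGraph hs 2 Lu)
    (hne : ∀ j, fixedSpace 𝓣.T (𝓣.P j) ≠ ⊥) :
    IsPartiallyHyperbolic (𝓣.perm hs) (fun x => fixedSpace 𝓣.T (𝓣.P 0 + Ls x))
      (fun _ => fixedSpace 𝓣.T (𝓣.P 1)) (fun x => fixedSpace 𝓣.T (𝓣.P 2 + Lu x)) where
  diffeo := 𝓣.isDiffeo_perm hs
  subbundle_ss := 𝓣.isSubbundle_graph hLs (by decide)
  subbundle_c := 𝓣.isSubbundle_center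
  subbundle_uu := 𝓣.isSubbundle_graph hLu (by decide)
  nontrivial x := ⟨𝓣.graph_ne_bot hLs (by decide) (hne 0) x, hne 1,
    𝓣.graph_ne_bot hLu (by decide) (hne 2) x⟩
  splitting := 𝓣.isInternal_graphs hLs hLu
  invariant_ss := hLs.map_eq (by decide)
  invariant_c := 𝓣.map_center
  invariant_uu := hLu.map_eq (by decide)
  rates := 𝓣.exists_rates hLs hLu

/-- The perturbed automorphism is partially hyperbolic, with the linear centre bundle. -/
theorem exists_memPH (S : Fin 3 → Submodule ℝ (E n))
    (hS : ∀ j v, v ∈ S j ↔ ∀ i, 𝓣.τ i ≠ j → 𝓣.T v i = 0) (hne : ∀ j, S j ≠ ⊥) :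
    ∃ Ess Euu, MemPH A (S 0) (S 1) (S 2) (𝓣.perm (Set.right_mem_Icc.2 zero_le_one)) Ess
      (fun _ => S 1) Euu := by
  obtain ⟨Ls, hLs⟩ := 𝓣.exists_stable_graph (Set.right_mem_Icc.2 zero_le_one)
  obtain ⟨Lu, hLu⟩ := 𝓣.exists_unstable_graph (Set.right_mem_Icc.2 zero_le_one)
  have e : ∀ j, S j = fixedSpace 𝓣.T (𝓣.P j) := fun j => by
    ext v
    rw [hS, mem_fixedSpace, SpectralData.P_apply_eq_self_iff]
  simp only [e] at hne ⊢
  exact ⟨_, _, 𝓣.isPartiallyHyperbolic hLs hLu hne, 𝓣.isotopic_perm,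
    fun x => hLs.finrank_eq (by decide) x, fun _ => rfl, fun x => hLu.finrank_eq (by decide) x⟩

/-- At the origin the rank-one term vanishes and `ψ 0 = 1`, so the central entries become `ν i - (ν
i - 1) = 1`. -/
theorem torusDeriv_zero_center {v : E n} (hv : ∀ i, 𝓣.τ i ≠ 1 → 𝓣.T v i = 0) :
    torusDeriv (𝓣.perm (Set.right_mem_Icc.2 zero_le_one)) 0 v = v := by
  have h := 𝓣.torusDeriv_perm_of_hasFDerivAt (s := 1) (Set.right_mem_Icc.2 zero_le_one) (x := 0)
    (M := 𝓣.locDeriv 1 0) (by rw [map_zero]; exact 𝓣.hasFDerivAt_zero 1)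
  rw [proj_zero] at h
  rw [h]
  change 𝓣.T.symm (𝓣.locDeriv 1 0 (𝓣.T v)) = v
  rw [ContinuousLinearEquiv.symm_apply_eq]
  ext i
  by_cases hi : 𝓣.τ i = 1
  · simp [Model.locDeriv, radialDeriv, 𝓣.profile.zero, SpectralData.δ, hi]
    ring
  · rw [𝓣.locDeriv_apply_of_ne _ _ _ hi, hv i hi, mul_zero]

end ToralModel

/-! ### Expansivity -/

theorem not_bounded_of_step {a : ℕ → ℝ} {ε D : ℝ} (hε : 0 < ε) (hstep : ∀ m, a m + ε ≤ a (m + 1))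
    (hD : ∀ m, a m ≤ D) : False := by
  have h : ∀ m : ℕ, a 0 + m * ε ≤ a m := fun m => by
    induction m with
    | zero => simp
    | succ m ih => push_cast; linarith [hstep m]
  obtain ⟨m, hm⟩ := exists_nat_gt ((D - a 0) / ε)
  rw [div_lt_iff₀ hε] at hm
  linarith [h m, hD m]

/-- A bounded two-sided orbit of a hyperbolic scalar multiplication vanishes. -/
theorem eq_zero_of_bounded_orbit {a : ℤ → ℝ} {ν D : ℝ} (hν : |ν| ≠ 1)
    (h : ∀ k, a (k + 1) = ν * a k) (hD : ∀ k, |a k| ≤ D) (k : ℤ) : a k = 0 := by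
  have hpow : ∀ (k : ℤ) (m : ℕ), a (k + m) = ν ^ m * a k := fun k m => by
    induction m with
    | zero => simp
    | succ m ih => push_cast; rw [← add_assoc, h, ih, pow_succ]; ring
  by_contra hne
  have hpos : 0 < |a k| := abs_pos.2 hne
  -- A contraction is tested along the past of the orbit, an expansion along its future.
  rcases lt_or_gt_of_ne hν with hlt | hgt
  · obtain ⟨m, hm⟩ := exists_pow_lt_of_lt_one (show 0 < |a k| / (D + 1) by
      have := hD k
      have : 0 < D + 1 := by linarith
      positivity) hlt
    have h1 := hpow (k - m) m
    rw [sub_add_cancel] at h1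
    have h2 : |a k| ≤ |ν| ^ m * D := by
      rw [h1, abs_mul, abs_pow]
      gcongr
      exact hD _
    have hD0 : 0 < D + 1 := by linarith [hD k]
    rw [lt_div_iff₀ hD0] at hm
    have : 0 ≤ |ν| ^ m := by positivity
    nlinarith
  · obtain ⟨m, hm⟩ := pow_unbounded_of_one_lt (D / |a k|) hgt
    rw [div_lt_iff₀ hpos] at hm
    have h1 := hD (k + m)
    rw [hpow, abs_mul, abs_pow] at h1
    linarith

/-- A bounded orbit along which the quadratic quantity `q` increases at a definite rate is
trivial. -/
theorem eq_zero_of_lyapunov {q N : ℤ → ℝ} {θ : ℝ → ℝ} {C D : ℝ} (hC : 0 ≤ C)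
    (hN : ∀ k, 0 ≤ N k) (hND : ∀ k, N k ≤ D) (hq : ∀ k, |q k| ≤ C * N k ^ 2)
    (hθmono : MonotoneOn θ (Set.Ici 0)) (hθ0 : ∀ t, 0 ≤ t → 0 ≤ θ t) (hθ : ∀ t, 0 < t → 0 < θ t)
    (hstep : ∀ k, q k + θ (N k) ≤ q (k + 1)) (k : ℤ) : N k = 0 := by
  have hqD : ∀ k, |q k| ≤ C * D ^ 2 := fun k => (hq k).trans (by
    have := hN k
    have := hND k
    gcongr)
  -- A value of `q` away from `0` keeps `N` away from `0`, which forces a definite increment. Using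
  -- `C + 1` avoids dividing by zero when `C = 0`.
  have hlow : ∀ c, 0 < c → ∃ ε, 0 < ε ∧ ∀ k, c ≤ |q k| → ε ≤ θ (N k) := fun c hc => by
    refine ⟨θ (Real.sqrt (c / (C + 1))), hθ _ (by positivity), fun k hk => ?_⟩
    refine hθmono (Real.sqrt_nonneg _) (hN k) (Real.sqrt_le_iff.2 ⟨hN k, ?_⟩)
    rw [div_le_iff₀ (by positivity)]
    nlinarith [hq k, sq_nonneg (N k)]
  -- A positive value stays bounded below by itself in the future, so `q` would grow without bound;
  -- a negative one is excluded in the same way along the past.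
  have hnonpos : ∀ k, q k ≤ 0 := fun k => by
    by_contra! hpos
    obtain ⟨ε, hε, h⟩ := hlow _ hpos
    have hge : ∀ m : ℕ, q k ≤ q (k + m) := fun m => by
      induction m with
      | zero => simp
      | succ m ih =>
        have := hstep (k + m)
        have := hθ0 _ (hN (k + m))
        push_cast
        rw [← add_assoc]
        linarith
    refine not_bounded_of_step (a := fun m : ℕ => q (k + m)) hε (fun m => ?_)
      fun m => (le_abs_self _).trans (hqD _)
    have h1 := h (k + m) ((hge m).trans (le_abs_self _))
    have h2 := hstep (k + m)
    push_cast
    rw [← add_assoc]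
    linarith
  have hnonneg : ∀ k, 0 ≤ q k := fun k => by
    by_contra! hneg
    obtain ⟨ε, hε, h⟩ := hlow (-q k) (by linarith)
    have hst : ∀ m : ℕ, q (k - (m + 1 : ℕ)) + θ (N (k - (m + 1 : ℕ))) ≤ q (k - m) := fun m => by
      have := hstep (k - (m + 1 : ℕ))
      rwa [show k - ((m + 1 : ℕ) : ℤ) + 1 = k - m by push_cast; ring] at this
    have hge : ∀ m : ℕ, q (k - m) ≤ q k := fun m => by
      induction m with
      | zero => simp
      | succ m ih =>
        have := hst m
        have := hθ0 _ (hN (k - (m + 1 : ℕ)))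
        linarith
    refine not_bounded_of_step (a := fun m : ℕ => -q (k - m)) hε (fun m => ?_)
      fun m => (neg_le_abs _).trans (hqD _)
    have h1 := h (k - (m + 1 : ℕ)) (le_trans (by linarith [hge (m + 1)]) (neg_le_abs _))
    have h2 := hst m
    linarith
  by_contra hne
  -- Now `q` vanishes identically, leaving no room for a positive increment.
  have h1 := hθ _ (lt_of_le_of_ne (hN k) (Ne.symm hne))
  linarith [hstep k, hnonneg k, hnonpos (k + 1)]

/-! ### Growth of the quadratic form on central differences. -/

namespace Model

variable {ι : Type*} [Fintype ι] (𝓜 : Model ι)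

/-- A quadratic form on the centre that increases along orbits. -/
def quad (w : EuclideanSpace ℝ ι) : ℝ := ∑ i, w i ^ 2 / 𝓜.δ i

/-- Noncentral indices have `δ i = 0` and contribute nothing to either side, by the convention for
division by zero. -/
theorem abs_quad_le (w : EuclideanSpace ℝ ι) :
    |𝓜.quad w| ≤ (∑ i, |𝓜.δ i|⁻¹) * ‖w‖ ^ 2 := by
  rw [quad, Finset.sum_mul]
  refine (Finset.abs_sum_le_sum_abs _ _).trans (Finset.sum_le_sum fun i _ => ?_)
  rw [abs_div, div_eq_inv_mul, abs_pow]
  gcongr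
  exact PiLp.norm_apply_le w i

/-- The weights `1 / δ i` are chosen to cancel the factor `δ i` in the cross term, which becomes the
plain inner product that the monotonicity estimates control. -/
theorem quad_add (w g : EuclideanSpace ℝ ι) (hw : ∀ i, 𝓜.τ i ≠ 1 → w i = 0) :
    𝓜.quad (w + diag 𝓜.δ g) = 𝓜.quad w + 2 * inner ℝ g w + ∑ i, 𝓜.δ i * g i ^ 2 := by
  rw [quad, quad, PiLp.inner_apply, Finset.mul_sum, ← Finset.sum_add_distrib,
    ← Finset.sum_add_distrib]
  refine Finset.sum_congr rfl fun i _ => ?_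
  simp only [PiLp.add_apply, diag_apply, RCLike.inner_apply, conj_trivial]
  by_cases hi : 𝓜.τ i = 1
  · have h0 : 𝓜.δ i ≠ 0 := by
      rw [SpectralData.δ, if_pos hi]
      exact sub_ne_zero.2 (𝓜.center i hi).2.2
    field_simp
    ring
  · simp [hw i hi, SpectralData.δ, hi]

/-- The expansion rate of `quad`. -/
def rate (t : ℝ) : ℝ := 𝓜.β * (1 - 𝓜.ψ ((t / 2) ^ 2)) * t ^ 2

theorem β_pos : 0 < 𝓜.β := 𝓜.α_nonneg.trans_lt 𝓜.α_lt

theorem rate_nonneg (t : ℝ) : 0 ≤ 𝓜.rate t := by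
  have := 𝓜.β_pos
  have : 0 ≤ 1 - 𝓜.ψ ((t / 2) ^ 2) := sub_nonneg.2 (𝓜.profile.le_one _)
  unfold rate
  positivity

theorem rate_pos {t : ℝ} (ht : 0 < t) : 0 < 𝓜.rate t := by
  have := 𝓜.β_pos
  have : 0 < 1 - 𝓜.ψ ((t / 2) ^ 2) := sub_pos.2 (𝓜.profile.lt_one _ (by positivity))
  unfold rate
  positivity

theorem monotoneOn_rate : MonotoneOn 𝓜.rate (Set.Ici 0) := by
  intro s hs t _ hst
  have hs' : (0 : ℝ) ≤ s := hs
  have := 𝓜.β_pos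
  have h1 : 0 ≤ 1 - 𝓜.ψ ((t / 2) ^ 2) := sub_nonneg.2 (𝓜.profile.le_one _)
  have h2 : 𝓜.ψ ((t / 2) ^ 2) ≤ 𝓜.ψ ((s / 2) ^ 2) :=
    𝓜.profile.antitone (sq_nonneg _ : (0 : ℝ) ≤ _) (sq_nonneg _ : (0 : ℝ) ≤ _) (by gcongr)
  unfold rate
  gcongr

/-- Nearby points see the same translate of the radial field. -/
theorem exists_field_eq (x : EuclideanSpace ℝ ι) {w : EuclideanSpace ℝ ι} (hw : ‖w‖ < 𝓜.r) :
    ∃ γ ∈ 𝓜.Γ, 𝓜.field x = radial 𝓜.ψ (x - γ) ∧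
      𝓜.field (x - w) = radial 𝓜.ψ (x - w - γ) := by
  obtain ⟨γ, hγ, h⟩ := exists_periodize_eq 𝓜.r_pos 𝓜.sep 𝓜.radial_zero_of_le x
  exact ⟨γ, hγ, h x (by simpa using 𝓜.r_pos), h (x - w) (by simpa using hw)⟩

/-- Ensures that the image of a small difference is still too short to jump to another lattice
translate. -/
theorem norm_map_sub_le (x : EuclideanSpace ℝ ι) {w : EuclideanSpace ℝ ι} (hw : ‖w‖ < 𝓜.r) :
    ‖𝓜.map 1 x - 𝓜.map 1 (x - w)‖ ≤ (‖diag 𝓜.ν‖ + 3 * 𝓜.β') * ‖w‖ := by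
  obtain ⟨γ, -, h1, h2⟩ := 𝓜.exists_field_eq x hw
  have e : 𝓜.map 1 x - 𝓜.map 1 (x - w) =
      diag 𝓜.ν w - diag 𝓜.δ (𝓜.field x - 𝓜.field (x - w)) := by
    simp only [map, one_smul, map_sub]
    abel
  have h3 : ‖𝓜.field x - 𝓜.field (x - w)‖ ≤ 3 * ‖w‖ := by
    rw [h1, h2]
    have := norm_radial_sub_le 𝓜.profile 𝓜.two_mul_le_one (x - γ) (x - w - γ)
    rwa [show x - γ - (x - w - γ) = w by abel] at this
  have hb := 𝓜.β'_pos
  rw [e]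
  calc _ ≤ ‖diag 𝓜.ν w‖ + ‖diag 𝓜.δ (𝓜.field x - 𝓜.field (x - w))‖ := norm_sub_le _ _
    _ ≤ ‖diag 𝓜.ν‖ * ‖w‖ + 𝓜.β' * (3 * ‖w‖) := by
        gcongr
        · exact ContinuousLinearMap.le_opNorm _ _
        · refine (norm_diag_le hb.le fun i _ => 𝓜.abs_δ_le i).trans ?_
          gcongr
    _ = _ := by ring

theorem quad_map_sub_ge (x : EuclideanSpace ℝ ι) {w : EuclideanSpace ℝ ι} (hw : ‖w‖ < 𝓜.r)
    (hc : ∀ i, 𝓜.τ i ≠ 1 → w i = 0) :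
    𝓜.quad w + 𝓜.rate ‖w‖ ≤ 𝓜.quad (𝓜.map 1 x - 𝓜.map 1 (x - w)) := by
  obtain ⟨γ, -, h1, h2⟩ := 𝓜.exists_field_eq x hw
  set g := w - (radial 𝓜.ψ (x - γ) - radial 𝓜.ψ (x - w - γ)) with hg
  have e : 𝓜.map 1 x - 𝓜.map 1 (x - w) = w + diag 𝓜.δ g := by
    rw [map, map, h1, h2, hg]
    ext i
    simp only [one_smul, map_sub, PiLp.sub_apply, PiLp.add_apply, diag_apply]
    by_cases hi : 𝓜.τ i = 1
    · simp only [SpectralData.δ, hi, if_true]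
      ring
    · simp only [SpectralData.δ, hi, if_false, hc i hi]
      ring
  have hw' : x - γ - (x - w - γ) = w := by abel
  have h3 := norm_sq_complement_sub_le 𝓜.profile 𝓜.two_mul_le_one (x - γ) (x - w - γ)
  have h4 := inner_complement_sub_ge 𝓜.profile (x - γ) (x - w - γ)
  rw [hw', ← hg] at h3 h4
  -- Only contracting directions lose, and by at most `1 - β`. With `‖g‖² ≤ 2⟨g, w⟩` a gain of
  -- `2β⟨g, w⟩` remains, which the quantitative monotonicity bounds below by `rate ‖w‖`.
  have h5 : -(1 - 𝓜.β) * ‖g‖ ^ 2 ≤ ∑ i, 𝓜.δ i * g i ^ 2 := by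
    rw [EuclideanSpace.norm_sq_eq, Finset.mul_sum]
    refine Finset.sum_le_sum fun i _ => ?_
    rw [Real.norm_eq_abs, sq_abs]
    have hβ := 𝓜.β_lt
    have : -(1 - 𝓜.β) ≤ 𝓜.δ i := by
      rw [SpectralData.δ]
      split_ifs with hi
      · linarith [(𝓜.center i hi).1]
      · linarith
    gcongr
  rw [e, 𝓜.quad_add w g hc, rate]
  have := 𝓜.β_lt
  have := 𝓜.β_pos
  nlinarith

/-- The difference of two orbits that stay close for all times vanishes. -/
theorem eq_zero_of_orbit_differences {X W : ℤ → EuclideanSpace ℝ ι} (hW : ∀ k, ‖W k‖ < 𝓜.r)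
    (h : ∀ k, W (k + 1) = 𝓜.map 1 (X k) - 𝓜.map 1 (X k - W k)) (k : ℤ) : W k = 0 := by
  have hc : ∀ k i, 𝓜.τ i ≠ 1 → W k i = 0 := fun k i hi => by
    refine eq_zero_of_bounded_orbit (a := fun k => W k i) (ν := 𝓜.ν i) (D := 𝓜.r) ?_ ?_ ?_ k
    · have hcases : ∀ j : Fin 3, j ≠ 1 → j = 0 ∨ j = 2 := by decide
      have h1 := 𝓜.α_lt
      have h2 := 𝓜.β_lt
      have h3 := 𝓜.lt_β'
      have h4 := 𝓜.β'_lt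
      rcases hcases _ hi with h0 | h0
      · have := 𝓜.stable i h0
        exact ne_of_lt (by linarith)
      · have := 𝓜.unstable i h0
        exact ne_of_gt (by linarith)
    · intro k
      simp only [h k, PiLp.sub_apply, 𝓜.map_apply_of_ne _ _ hi]
      ring
    · exact fun k => (PiLp.norm_apply_le (W k) i).trans (hW k).le
  have := eq_zero_of_lyapunov (q := fun k => 𝓜.quad (W k)) (N := fun k => ‖W k‖)
    (Finset.sum_nonneg fun i _ => by positivity) (fun k => norm_nonneg _) (fun k => (hW k).le)
    (fun k => 𝓜.abs_quad_le (W k)) 𝓜.monotoneOn_rate (fun t _ => 𝓜.rate_nonneg t)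
    (fun t => 𝓜.rate_pos) (fun k => by
      rw [h k]
      exact 𝓜.quad_map_sub_ge (X k) (hW k) (hc k)) k
  simpa using this

end Model

theorem exists_proj_eq_sub {n : ℕ} (x y : Torus n) :
    ∃ w : E n, proj w = x - y ∧ ∀ i, |w i| ≤ dist x y := by
  have h : ∀ i, ∃ t : ℝ, (t : UnitAddCircle) = x i - y i ∧ |t| ≤ dist x y := fun i => by
    obtain ⟨t, ht⟩ := QuotientAddGroup.mk_surjective (x i - y i)
    refine ⟨t - round t, ?_, ?_⟩
    · rw [← ht]
      rw [AddCircle.coe_sub, sub_eq_self, AddCircle.coe_eq_zero_iff]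
      exact ⟨round t, by simp⟩
    · rw [← UnitAddCircle.norm_eq]
      rw [ht, ← dist_eq_norm]
      exact dist_le_pi_dist x y i
  choose t ht ht' using h
  exact ⟨WithLp.toLp 2 t, funext fun i => ht i, ht'⟩

/-! ### Expansivity on the torus. -/

namespace ToralModel

variable {n : ℕ} {A : Matrix.SpecialLinearGroup (Fin n) ℤ} {ι : Type*} [Fintype ι]
  (𝓣 : ToralModel A ι)

/-- Small lifts `w k` of the differences of two close orbits obey the recursion of the model map
exactly. The base lifts `u k` are chosen independently at each time; equivariance makes this
harmless. -/
theorem isExpansive_perm : IsExpansive (𝓣.perm (Set.right_mem_Icc.2 zero_le_one)) := by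
  set hs : (1 : ℝ) ∈ Set.Icc (0 : ℝ) 1 := Set.right_mem_Icc.2 zero_le_one
  have hr := 𝓣.r_pos
  have hb := 𝓣.β'_pos
  set C : ℝ := ‖diag 𝓣.ν‖ + 3 * 𝓣.β' with hC
  have hC0 : 0 ≤ C := by positivity
  -- With this bound, the defect in the recursion is at most `C ρ + ρ = r`. It lies in `Γ`, whose
  -- nonzero elements have norm at least `8r`, so it vanishes.
  set ρ : ℝ := 𝓣.r / (C + 1) with hρ
  have hρ0 : 0 < ρ := by positivity
  have hρr : ρ ≤ 𝓣.r := div_le_self hr.le (by linarith)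
  have hCρ : (C + 1) * ρ = 𝓣.r := by rw [hρ]; field_simp
  obtain ⟨δ, hδ, hδρ⟩ : ∃ δ > 0, ∀ w : E n, (∀ i, |w i| ≤ δ) → ‖𝓣.T w‖ < ρ := by
    set K : ℝ := ‖(𝓣.T : E n →L[ℝ] EuclideanSpace ℝ ι)‖ with hK
    have hK0 : 0 ≤ K := norm_nonneg _
    refine ⟨ρ / ((K + 1) * (n + 1)), by positivity, fun w hw => ?_⟩
    set δ := ρ / ((K + 1) * (n + 1)) with hδ
    have hδ0 : 0 < δ := by positivity
    have h1 : ‖w‖ ≤ (n + 1) * δ := by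
      refine (sq_le_sq₀ (norm_nonneg _) (by positivity)).1 ?_
      rw [EuclideanSpace.norm_sq_eq]
      calc ∑ i, ‖w i‖ ^ 2 ≤ ∑ _i : Fin n, δ ^ 2 := Finset.sum_le_sum fun i _ => by
            rw [Real.norm_eq_abs]
            have := hw i
            gcongr
        _ = n * δ ^ 2 := by simp
        _ ≤ ((n + 1) * δ) ^ 2 := by
            rw [mul_pow]
            gcongr
            have : (0 : ℝ) ≤ n := Nat.cast_nonneg n
            nlinarith
    calc ‖𝓣.T w‖ ≤ K * ‖w‖ := (𝓣.T : E n →L[ℝ] EuclideanSpace ℝ ι).le_opNorm w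
      _ ≤ K * ((n + 1) * δ) := by gcongr
      _ < (K + 1) * ((n + 1) * δ) := by gcongr; linarith
      _ = ρ := by rw [hδ]; field_simp
  refine ⟨δ, hδ, fun x y hxy => ?_⟩
  choose w hw hwle using fun k : ℤ => exists_proj_eq_sub ((𝓣.perm hs ^ k) x) ((𝓣.perm hs ^ k) y)
  choose u hu using fun k : ℤ => proj_surjective ((𝓣.perm hs ^ k) x)
  have hsmall : ∀ k, ‖𝓣.T (w k)‖ < ρ := fun k => hδρ _ fun i => (hwle k i).trans (hxy k)
  have hstep : ∀ k, 𝓣.T (w (k + 1)) =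
      𝓣.map 1 (𝓣.T (u k)) - 𝓣.map 1 (𝓣.T (u k) - 𝓣.T (w k)) := fun k => by
    have hperm : ∀ z, (𝓣.perm hs ^ (k + 1)) z = 𝓣.perm hs ((𝓣.perm hs ^ k) z) := fun z => by
      rw [add_comm, zpow_add, zpow_one, Equiv.Perm.mul_apply]
    have hy : proj (u k - w k) = (𝓣.perm hs ^ k) y := by
      rw [proj_sub, hu, hw]
      abel
    have hmem : 𝓣.map 1 (𝓣.T (u k)) - 𝓣.map 1 (𝓣.T (u k) - 𝓣.T (w k)) - 𝓣.T (w (k + 1)) ∈ 𝓣.Γ := by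
      rw [𝓣.mem_Γ, map_sub, map_sub, ContinuousLinearEquiv.symm_apply_apply, ← map_sub 𝓣.T,
        ← 𝓣.lift_apply hs, ← 𝓣.lift_apply hs, proj_sub, proj_sub, ← perm_proj, ← perm_proj, hu, hy,
        hw, hperm, hperm, sub_self]
    by_contra hne
    have h1 := 𝓣.sep _ hmem (fun h0 => hne (sub_eq_zero.1 h0).symm)
    have h2 := 𝓣.norm_map_sub_le (𝓣.T (u k)) ((hsmall k).trans_le hρr)
    have h3 := norm_sub_le (𝓣.map 1 (𝓣.T (u k)) - 𝓣.map 1 (𝓣.T (u k) - 𝓣.T (w k))) (𝓣.T (w (k + 1)))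
    have h4 := hsmall (k + 1)
    have h5 : C * ‖𝓣.T (w k)‖ ≤ C * ρ := by have := (hsmall k).le; gcongr
    linarith
  have h0 := 𝓣.eq_zero_of_orbit_differences (X := fun k => 𝓣.T (u k)) (W := fun k => 𝓣.T (w k))
    (fun k => (hsmall k).trans_le hρr) hstep 0
  have h1 : w 0 = 0 := by simpa using h0
  have h2 := hw 0
  rw [h1, proj_zero] at h2
  simpa [sub_eq_zero, eq_comm] using h2

end ToralModel

/-! ### Existence of the perturbation -/

/-- The lattice `ℤⁿ` in the coordinates `T`. -/
def lattice {n : ℕ} {X : Type*} [NormedAddCommGroup X] [NormedSpace ℝ X] (T : E n ≃L[ℝ] X) :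
    AddSubgroup X where
  carrier := {y | proj (T.symm y) = 0}
  zero_mem' := by simp [proj_zero]
  add_mem' {x y} hx hy := by
    simp only [Set.mem_ofPred_eq] at *
    rw [map_add, proj_add, hx, hy, add_zero]
  neg_mem' {x} hx := by
    simp only [Set.mem_ofPred_eq] at *
    rw [← zero_sub, map_sub, map_zero, proj_sub, hx, proj_zero, sub_zero]

theorem exists_perturbation {n : ℕ} {A : Matrix.SpecialLinearGroup (Fin n) ℤ} {ι : Type*}
    [Fintype ι] (S : SpectralData ι) (b : Module.Basis ι ℝ (E n))
    (hb : ∀ i, linMap A (b i) = S.ν i • b i) (V : Fin 3 → Submodule ℝ (E n))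
    (hmem : ∀ i, b i ∈ V (S.τ i)) (hrepr : ∀ j, ∀ v ∈ V j, ∀ i, S.τ i ≠ j → b.repr v i = 0)
    (hne : ∀ j, V j ≠ ⊥) {ε : ℝ} (hε : 0 < ε) :
    ∃ (f : Equiv.Perm (Torus n)) (Ess Euu : Torus n → Submodule ℝ (E n)),
      MemPH A (V 0) (V 1) (V 2) f Ess (fun _ => V 1) Euu ∧
      (∀ x, x ∉ proj '' Metric.ball (0 : E n) ε → f x = toralAut A x) ∧
      IsExpansive f ∧ f 0 = 0 ∧ ∀ v ∈ V 1, torusDeriv f 0 v = v := by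
  let T : E n ≃L[ℝ] EuclideanSpace ℝ ι :=
    (b.equivFun.trans (WithLp.linearEquiv 2 ℝ (ι → ℝ)).symm).toContinuousLinearEquiv
  have hTi : ∀ v i, T v i = b.repr v i := fun v i => rfl
  have hTb : ∀ x, T (linMap A x) = diag S.ν (T x) := by
    have : (T : E n →ₗ[ℝ] EuclideanSpace ℝ ι) ∘ₗ linMap A =
        (diag S.ν : EuclideanSpace ℝ ι →ₗ[ℝ] EuclideanSpace ℝ ι) ∘ₗ
          (T : E n →ₗ[ℝ] EuclideanSpace ℝ ι) := by
      refine b.ext fun i => ?_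
      ext k
      change T (linMap A (b i)) k = S.ν k * T (b i) k
      rw [hb, hTi, hTi, map_smul, Finsupp.smul_apply, smul_eq_mul]
      classical
      rw [b.repr_self, Finsupp.single_apply]
      split_ifs with h
      · rw [h]
      · simp
    exact fun x => congrArg (fun f => f x) this
  have hV : ∀ j v, v ∈ V j ↔ ∀ i, S.τ i ≠ j → T v i = 0 := fun j v => by
    refine ⟨fun hv => hrepr j v hv, fun h => ?_⟩
    rw [← b.sum_repr v]
    refine Submodule.sum_mem _ fun i _ => ?_
    by_cases hi : S.τ i = j
    · exact Submodule.smul_mem _ _ (hi ▸ hmem i)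
    · have : b.repr v i = 0 := h i hi
      rw [this, zero_smul]
      exact Submodule.zero_mem _
  set K : ℝ := ‖(T.symm : EuclideanSpace ℝ ι →L[ℝ] E n)‖ + 1 with hK
  have hK0 : 0 < K := by positivity
  have hTK : ∀ y, ‖T.symm y‖ ≤ K * ‖y‖ := fun y =>
    ((T.symm : EuclideanSpace ℝ ι →L[ℝ] E n).le_opNorm y).trans (by gcongr; linarith)
  -- The first bound separates the lattice, whose nonzero points have norm at least `1` before
  -- applying `T`; the second keeps the support inside the ball of radius `ε`.
  set r : ℝ := min (1 / (8 * K)) (ε / K) with hr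
  have hr0 : 0 < r := lt_min (by positivity) (by positivity)
  have hr1 : 8 * r * K ≤ 1 := by
    have : r ≤ 1 / (8 * K) := min_le_left _ _
    rw [le_div_iff₀ (by positivity)] at this
    linarith
  have hr2 : K * r ≤ ε := by
    have : r ≤ ε / K := min_le_right _ _
    rw [le_div_iff₀ hK0] at this
    linarith
  have hη : 0 < S.margin / (2 * S.β') := by
    have := S.margin_pos
    have := S.β'_pos
    positivity
  obtain ⟨ψ, hψ⟩ := exists_isProfile hη (pow_pos hr0 2)
  let 𝓣 : ToralModel A ι :=
    { S with
      Γ := lattice T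
      r := r
      ψ := ψ
      r_pos := hr0
      sep := fun γ hγ hne => by
        have h1 := one_le_norm_of_proj_eq_zero (x := T.symm γ) hγ (by simpa using hne)
        have h2 := hTK γ
        by_contra! hlt
        nlinarith
      profile := hψ
      T := T
      T_linMap := hTb
      mem_Γ := fun _ => Iff.rfl }
  obtain ⟨Ess, Euu, h⟩ := 𝓣.exists_memPH V hV hne
  refine ⟨_, Ess, Euu, h, ?_, 𝓣.isExpansive_perm, 𝓣.perm_zero _,
    fun v hv => 𝓣.torusDeriv_zero_center ((hV 1 v).1 hv)⟩
  refine fun x hx => 𝓣.perm_eq_toralAut_of_notMem _ (fun y hy => ?_) x hx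
  have hy : ‖y‖ < r := hy
  calc ‖T.symm y‖ ≤ K * ‖y‖ := hTK y
    _ < K * r := by gcongr
    _ ≤ ε := hr2

/-! ### Symmetric automorphisms -/

theorem isSmoothLift_linMap {n : ℕ} (A : Matrix.SpecialLinearGroup (Fin n) ℤ) :
    IsSmoothLift (linMap A) (toralAut A) :=
  ⟨(LinearMap.toContinuousLinearMap (linMap A)).contDiff, proj_linMap A⟩

theorem torusDeriv_toralAut {n : ℕ} (A : Matrix.SpecialLinearGroup (Fin n) ℤ) (x : Torus n) :
    torusDeriv (toralAut A) x = LinearMap.toContinuousLinearMap (linMap A) := by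
  obtain ⟨x, rfl⟩ := proj_surjective x
  rw [torusDeriv_proj (isSmoothLift_linMap A)]
  exact (LinearMap.toContinuousLinearMap (linMap A)).hasFDerivAt.fderiv

theorem linMap_injective {n : ℕ} (A : Matrix.SpecialLinearGroup (Fin n) ℤ) :
    Function.Injective (linMap A) := by
  have h : ∀ x, linMap A⁻¹ (linMap A x) = x := fun x => by
    have h1 : (A⁻¹).1.map (Int.cast : ℤ → ℝ) * A.1.map (Int.cast : ℤ → ℝ) = 1 := by
      rw [← Matrix.map_mul_intCast, ← Matrix.SpecialLinearGroup.coe_mul, inv_mul_cancel,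
        Matrix.SpecialLinearGroup.coe_one]
      simp
    ext i
    simp only [linMap, Matrix.toLpLin_apply, Matrix.mulVec_mulVec]
    rw [h1, Matrix.one_mulVec]
  exact Function.LeftInverse.injective h

theorem isSymmetric_linMap {n : ℕ} {A : Matrix.SpecialLinearGroup (Fin n) ℤ} (hA : A.1.IsSymm) :
    (linMap A).IsSymmetric := by
  rw [linMap, Matrix.isSymmetric_toEuclideanLin_iff, Matrix.IsHermitian,
    Matrix.conjTranspose_eq_transpose_of_trivial]
  exact hA.map _

/-- The spectral theorem on an invariant subspace. Symmetry of `A` serves to diagonalise the strong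
bundles, where no eigenbasis is given. -/
theorem exists_eigenbasis {n : ℕ} {A : Matrix.SpecialLinearGroup (Fin n) ℤ} (hA : A.1.IsSymm)
    (S : Submodule ℝ (E n)) (hS : ∀ v ∈ S, linMap A v ∈ S) :
    ∃ (m : ℕ) (b : Module.Basis (Fin m) ℝ S) (μ : Fin m → ℝ),
      ∀ i, linMap A (b i) = μ i • (b i : E n) := by
  have h := (isSymmetric_linMap hA).restrict_invariant hS
  refine ⟨_, (h.eigenvectorBasis rfl).toBasis, h.eigenvalues rfl, fun i => ?_⟩
  rw [OrthonormalBasis.coe_toBasis]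
  exact congrArg Subtype.val (h.apply_eigenvectorBasis rfl i)

theorem RiemMetric.norm_smul {n : ℕ} (g : RiemMetric n) (x : Torus n) (c : ℝ) (v : E n) :
    g.norm x (c • v) = |c| * g.norm x v := by
  simp only [RiemMetric.norm, map_smul, FunLike.coe_smul, Pi.smul_apply, smul_eq_mul]
  rw [← mul_assoc, ← sq, Real.sqrt_mul (sq_nonneg c), Real.sqrt_sq_eq_abs]

theorem RiemMetric.norm_pos {n : ℕ} (g : RiemMetric n) (x : Torus n) {v : E n} (hv : v ≠ 0) :
    0 < g.norm x v := Real.sqrt_pos.2 (g.pos x v hv)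

theorem exists_perturbation_of_isSymm {n k : ℕ} {A : Matrix.SpecialLinearGroup (Fin n) ℤ}
    {Sss Sc Suu : Submodule ℝ (E n)} {lam : Fin k → ℝ} (b : Module.Basis (Fin k) ℝ Sc)
    (hA : A.1.IsSymm)
    (hPH : IsPartiallyHyperbolic (toralAut A) (fun _ => Sss) (fun _ => Sc) (fun _ => Suu))
    (hlam : ∀ i, 0 < lam i ∧ lam i < 1) (hb : ∀ i, linMap A (b i) = lam i • (b i : E n))
    {ε : ℝ} (hε : 0 < ε) :
    ∃ (f : Equiv.Perm (Torus n)) (Ess Euu : Torus n → Submodule ℝ (E n)),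
      MemPH A Sss Sc Suu f Ess (fun _ => Sc) Euu ∧
      (∀ x, x ∉ proj '' Metric.ball (0 : E n) ε → f x = toralAut A x) ∧
      IsExpansive f ∧ f 0 = 0 ∧ ∀ v ∈ Sc, torusDeriv f 0 v = v := by
  obtain ⟨g, ls, lc, lc', lu, hls, hlu, h1, h2, h3, hrates⟩ := hPH.rates
  have hrate := hrates 0
  simp only [torusDeriv_toralAut, toralAut_zero, LinearMap.coe_toContinuousLinearMap'] at hrate
  have hinv : ∀ {S : Submodule ℝ (E n)},
      S.map (torusDeriv (toralAut A) 0 : E n →ₗ[ℝ] E n) = S → ∀ v ∈ S, linMap A v ∈ S := by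
    intro S hS v hv
    rw [← hS, torusDeriv_toralAut]
    exact ⟨v, hv, rfl⟩
  obtain ⟨hns, hnc, hnu⟩ := hPH.nontrivial 0
  -- the modulus of an eigenvalue is its rate in the metric at the fixed point
  have heig : ∀ {v : E n} {μ : ℝ}, v ≠ 0 → linMap A v = μ • v →
      (v ∈ Sss → |μ| < ls) ∧ (v ∈ Sc → lc < |μ| ∧ |μ| < lc') ∧ (v ∈ Suu → lu < |μ|) := by
    intro v μ hv hμ
    have h := hrate v hv
    have hp := g.norm_pos 0 hv
    rw [hμ, g.norm_smul] at h
    exact ⟨fun hm => lt_of_mul_lt_mul_right (h.1 hm) hp.le,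
      fun hm => ⟨lt_of_mul_lt_mul_right (h.2.1 hm).1 hp.le,
        lt_of_mul_lt_mul_right (h.2.1 hm).2 hp.le⟩,
      fun hm => lt_of_mul_lt_mul_right (h.2.2 hm) hp.le⟩
  have hls0 : 0 ≤ ls := by
    obtain ⟨v, hv, hv0⟩ := Submodule.exists_mem_ne_zero_of_ne_bot hns
    have h := (hrate v hv0).1 hv
    have hp := g.norm_pos 0 hv0
    have : 0 ≤ g.norm 0 (linMap A v) := Real.sqrt_nonneg _
    by_contra! hneg
    nlinarith
  let V : Fin 3 → Submodule ℝ (E n) := ![Sss, Sc, Suu]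
  have hbases : ∀ j, ∃ (m : ℕ) (c : Module.Basis (Fin m) ℝ (V j)) (μ : Fin m → ℝ),
      ∀ i, linMap A (c i) = μ i • (c i : E n) ∧ (j = 1 → 0 < μ i ∧ μ i < 1) := by
    intro j
    fin_cases j
    · obtain ⟨m, c, μ, h⟩ := exists_eigenbasis hA Sss (hinv (hPH.invariant_ss 0))
      exact ⟨m, c, μ, fun i => ⟨h i, fun h => absurd h (by decide)⟩⟩
    · exact ⟨k, b, lam, fun i => ⟨hb i, fun _ => hlam i⟩⟩
    · obtain ⟨m, c, μ, h⟩ := exists_eigenbasis hA Suu (hinv (hPH.invariant_uu 0))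
      exact ⟨m, c, μ, fun i => ⟨h i, fun h => absurd h (by decide)⟩⟩
  choose m c μ hc using hbases
  have hc0 : ∀ j i, (c j i : E n) ≠ 0 := fun j i => by
    simpa using (c j).ne_zero i
  have hint : DirectSum.IsInternal V := hPH.splitting 0
  have hcol : ∀ a : Σ j, Fin (m j), hint.collectedBasis c a = (c a.1 a.2 : E n) := fun a => by
    rw [hint.collectedBasis_coe]
  have hmin := min_le_left lc 1
  have hmin' := min_le_right lc 1
  have hmax := le_max_left lc' 1
  have hmax' := le_max_right lc' 1
  have hmin'' : ls < min lc 1 := lt_min h1 hls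
  have hmax'' : max lc' 1 < lu := max_lt h3 hlu
  let S : SpectralData (Σ j, Fin (m j)) :=
    { ν := fun a => μ a.1 a.2
      τ := fun a => a.1
      α := ls
      -- Midpoints put `β` strictly between `ls` and `1`, and `β'` strictly between `1` and `lu`.
      -- The range must contain `1`, which the central spectrum lies entirely below.
      β := (ls + min lc 1) / 2
      β' := (max lc' 1 + lu) / 2
      κ := lu
      α_nonneg := hls0
      α_lt := by linarith
      β_lt := by linarith
      lt_β' := by linarith
      β'_lt := by linarith
      ν_ne_zero := fun a h0 => by
        have h := (hc a.1 a.2).1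
        simp only [h0, zero_smul] at h
        exact hc0 a.1 a.2 (linMap_injective A (by rw [h, map_zero]))
      stable := by
        rintro ⟨j, i⟩ (rfl : j = 0)
        exact ((heig (hc0 0 i) (hc 0 i).1).1 (c 0 i).2).le
      center := by
        rintro ⟨j, i⟩ (rfl : j = 1)
        obtain ⟨hpos, hlt⟩ := (hc 1 i).2 rfl
        have h := (heig (hc0 1 i) (hc 1 i).1).2.1 (c 1 i).2
        rw [abs_of_pos hpos] at h
        exact ⟨by linarith [h.1], by linarith [h.2], hlt.ne⟩
      unstable := by
        rintro ⟨j, i⟩ (rfl : j = 2)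
        exact ((heig (hc0 2 i) (hc 2 i).1).2.2 (c 2 i).2).le }
  refine exists_perturbation S (hint.collectedBasis c) (fun a => ?_) V (fun a => ?_)
    (fun j v hv a ha => ?_) (fun j => ?_) hε
  · rw [hcol]
    exact (hc a.1 a.2).1
  · rw [hcol]
    exact (c a.1 a.2).2
  · exact hint.collectedBasis_repr_of_mem_ne c (Ne.symm ha) hv
  · fin_cases j
    · exact hns
    · exact hnc
    · exact hnu

/-! ### Automorphisms of the four-dimensional torus -/

/-- Four distinct eigenvalues in dimension four give an eigenbasis without symmetry, and `l < 1 < m`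
serve directly as the ends of the central range. -/
theorem exists_perturbation_of_eigenvalues {A : Matrix.SpecialLinearGroup (Fin 4) ℤ}
    {lss l m muu : ℝ} (h0 : 0 < lss) (h1 : lss < l) (h2 : l < 1) (h3 : 1 < m) (h4 : m < muu)
    (hss : Module.End.HasEigenvalue (linMap A) lss) (hl : Module.End.HasEigenvalue (linMap A) l)
    (hm : Module.End.HasEigenvalue (linMap A) m)
    (huu : Module.End.HasEigenvalue (linMap A) muu) {ε : ℝ} (hε : 0 < ε) :
    Module.finrank ℝ (Module.End.eigenspace (linMap A) l ⊔ Module.End.eigenspace (linMap A) m :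
      Submodule ℝ (E 4)) = 2 ∧
    ∃ (f : Equiv.Perm (Torus 4)) (Ess Euu : Torus 4 → Submodule ℝ (E 4)),
      MemPH A (Module.End.eigenspace (linMap A) lss)
        (Module.End.eigenspace (linMap A) l ⊔ Module.End.eigenspace (linMap A) m)
        (Module.End.eigenspace (linMap A) muu) f Ess
        (fun _ => Module.End.eigenspace (linMap A) l ⊔ Module.End.eigenspace (linMap A) m) Euu ∧
      (∀ x, x ∉ proj '' Metric.ball (0 : E 4) ε → f x = toralAut A x) ∧
      IsExpansive f ∧ f 0 = 0 ∧
      ∀ v ∈ (Module.End.eigenspace (linMap A) l ⊔ Module.End.eigenspace (linMap A) m :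
        Submodule ℝ (E 4)), torusDeriv f 0 v = v := by
  let ν : Fin 4 → ℝ := ![lss, l, m, muu]
  have hν : StrictMono ν := by
    rw [Fin.strictMono_iff_lt_succ]
    intro i
    fin_cases i
    · exact h1
    · exact h2.trans h3
    · exact h4
  have hev : ∀ i, ∃ v, Module.End.HasEigenvector (linMap A) (ν i) v := fun i => by
    fin_cases i
    · exact hss.exists_hasEigenvector
    · exact hl.exists_hasEigenvector
    · exact hm.exists_hasEigenvector
    · exact huu.exists_hasEigenvector
  choose v hv using hev
  have hli : LinearIndependent ℝ v :=
    Module.End.eigenvectors_linearIndependent' (linMap A) ν hν.injective v hv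
  let b : Module.Basis (Fin 4) ℝ (E 4) := basisOfLinearIndependentOfCardEqFinrank hli (by simp)
  have hbv : ∀ i, b i = v i := fun i => by simp [b]
  have hb : ∀ i, linMap A (b i) = ν i • b i := fun i => by
    rw [hbv]
    exact (hv i).apply_eq_smul
  have hrepr : ∀ x i, b.repr (linMap A x) i = ν i * b.repr x i := fun x i => by
    conv_lhs => rw [← b.sum_repr x]
    simp only [map_sum, map_smul, hb, Finsupp.coe_finsetSum, Finset.sum_apply, Finsupp.smul_apply,
      b.repr_self, smul_eq_mul, Finsupp.single_apply]
    simp [mul_comm]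
  have heig : ∀ {x : E 4} {i j : Fin 4}, x ∈ Module.End.eigenspace (linMap A) (ν j) → i ≠ j →
      b.repr x i = 0 := fun {x i j} hx hij => by
    have h := hrepr x i
    rw [Module.End.mem_eigenspace_iff.1 hx, map_smul, Finsupp.smul_apply, smul_eq_mul] at h
    have hne := hν.injective.ne hij
    by_contra h0
    exact hne (mul_right_cancel₀ h0 h).symm
  have hbmem : ∀ i, b i ∈ Module.End.eigenspace (linMap A) (ν i) := fun i =>
    Module.End.mem_eigenspace_iff.2 (hb i)
  let V : Fin 3 → Submodule ℝ (E 4) := ![Module.End.eigenspace (linMap A) lss,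
    Module.End.eigenspace (linMap A) l ⊔ Module.End.eigenspace (linMap A) m,
    Module.End.eigenspace (linMap A) muu]
  have hV1 : ∀ x ∈ V 1, b.repr x 0 = 0 ∧ b.repr x 3 = 0 := fun x hx => by
    obtain ⟨y, hy, z, hz, rfl⟩ := Submodule.mem_sup.1 hx
    have hy : y ∈ Module.End.eigenspace (linMap A) (ν 1) := hy
    have hz : z ∈ Module.End.eigenspace (linMap A) (ν 2) := hz
    rw [map_add, Finsupp.add_apply, Finsupp.add_apply, heig hy (by decide), heig hz (by decide),
      heig hy (by decide), heig hz (by decide), add_zero]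
    exact ⟨rfl, rfl⟩
  have hb1 : b 1 ∈ V 1 := (le_sup_left : _ ≤ V 1) (hbmem 1)
  have hb2 : b 2 ∈ V 1 := (le_sup_right : _ ≤ V 1) (hbmem 2)
  constructor
  · have hspan : V 1 = Submodule.span ℝ (Set.range ![b 1, b 2]) := by
      apply le_antisymm
      · intro x hx
        obtain ⟨e0, e3⟩ := hV1 x hx
        rw [← b.sum_repr x, Fin.sum_univ_four, e0, e3, zero_smul, zero_smul, zero_add, add_zero]
        exact Submodule.add_mem _ (Submodule.smul_mem _ _ (Submodule.subset_span ⟨0, rfl⟩))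
          (Submodule.smul_mem _ _ (Submodule.subset_span ⟨1, rfl⟩))
      · rw [Submodule.span_le]
        rintro _ ⟨i, rfl⟩
        fin_cases i
        · exact hb1
        · exact hb2
    have hli2 : LinearIndependent ℝ ![b 1, b 2] := by
      have := b.linearIndependent.comp ![1, 2] (by decide)
      convert this using 1
      ext i
      fin_cases i <;> rfl
    change Module.finrank ℝ (V 1) = 2
    rw [hspan, finrank_span_eq_card hli2, Fintype.card_fin]
  · have hcases : ∀ i : Fin 4, i = 0 ∨ i = 1 ∨ i = 2 ∨ i = 3 := by decide
    let S : SpectralData (Fin 4) :=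
      { ν := ν
        τ := ![0, 1, 1, 2]
        α := lss
        β := l
        β' := m
        κ := muu
        α_nonneg := h0.le
        α_lt := h1
        β_lt := h2
        lt_β' := h3
        β'_lt := h4
        ν_ne_zero := fun i => by
          have : 0 < ν i := h0.trans_le (hν.monotone (Fin.zero_le i))
          exact this.ne'
        stable := fun i hi => by
          rcases hcases i with rfl | rfl | rfl | rfl
          · exact (abs_of_pos h0).le
          · exact absurd hi (by decide)
          · exact absurd hi (by decide)
          · exact absurd hi (by decide)
        center := fun i hi => by
          rcases hcases i with rfl | rfl | rfl | rfl
          · exact absurd hi (by decide)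
          · exact ⟨le_rfl, (h2.trans h3).le, h2.ne⟩
          · exact ⟨(h2.trans h3).le, le_rfl, h3.ne'⟩
          · exact absurd hi (by decide)
        unstable := fun i hi => by
          rcases hcases i with rfl | rfl | rfl | rfl
          · exact absurd hi (by decide)
          · exact absurd hi (by decide)
          · exact absurd hi (by decide)
          · exact le_abs_self muu }
    refine exists_perturbation S b hb V (fun i => ?_) (fun j x hx i hi => ?_) (fun j => ?_) hε
    · rcases hcases i with rfl | rfl | rfl | rfl
      · exact hbmem 0
      · exact hb1
      · exact hb2
      · exact hbmem 3
    · have hV0 : x ∈ V 0 → ∀ i : Fin 4, i ≠ 0 → b.repr x i = 0 := fun hx i hi =>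
        heig (j := 0) hx hi
      have hV2 : x ∈ V 2 → ∀ i : Fin 4, i ≠ 3 → b.repr x i = 0 := fun hx i hi =>
        heig (j := 3) hx hi
      fin_cases j
      · refine hV0 hx i ?_
        rintro rfl
        exact hi rfl
      · rcases hcases i with rfl | rfl | rfl | rfl
        · exact (hV1 x hx).1
        · exact absurd rfl hi
        · exact absurd rfl hi
        · exact (hV1 x hx).2
      · refine hV2 hx i ?_
        rintro rfl
        exact hi rfl
    · have hbot : ∀ {U : Submodule ℝ (E 4)} {i : Fin 4}, b i ∈ U → U ≠ ⊥ := fun {U i} hi hU =>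
        b.ne_zero i (by rwa [hU, Submodule.mem_bot] at hi)
      fin_cases j
      · exact hbot (hbmem 0)
      · exact hbot hb1
      · exact hbot (hbmem 3)

end

end ToralPH

theorem mainTheorem5 :
    (∀ (n k : ℕ) (A : Matrix.SpecialLinearGroup (Fin n) ℤ)
        (Sss Sc Suu : Submodule ℝ (ToralPH.E n)) (lam : Fin k → ℝ)
        (b : Module.Basis (Fin k) ℝ Sc),
        A.1.IsSymm →
        ToralPH.IsPartiallyHyperbolic (ToralPH.toralAut A)
          (fun _ => Sss) (fun _ => Sc) (fun _ => Suu) →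
        Monotone lam → (∀ i, 0 < lam i ∧ lam i < 1) →
        (∀ i, ToralPH.linMap A (b i) = lam i • (b i : ToralPH.E n)) →
        ∀ ε : ℝ, 0 < ε →
          ∃ (f : Equiv.Perm (ToralPH.Torus n))
            (Ess Ec Euu : ToralPH.Torus n → Submodule ℝ (ToralPH.E n)),
            ToralPH.MemPH A Sss Sc Suu f Ess Ec Euu ∧
            (∀ x, x ∉ ToralPH.proj '' Metric.ball (0 : ToralPH.E n) ε →
              f x = ToralPH.toralAut A x) ∧
            ToralPH.IsExpansive f ∧
            f 0 = 0 ∧ ∀ v ∈ Ec 0, ToralPH.torusDeriv f 0 v = v) ∧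
    (∀ (A : Matrix.SpecialLinearGroup (Fin 4) ℤ) (lss l m muu : ℝ),
        0 < lss → lss < l → l < 1 → 1 < m → m < muu →
        Module.End.HasEigenvalue (ToralPH.linMap A) lss →
        Module.End.HasEigenvalue (ToralPH.linMap A) l →
        Module.End.HasEigenvalue (ToralPH.linMap A) m →
        Module.End.HasEigenvalue (ToralPH.linMap A) muu →
        ∀ ε : ℝ, 0 < ε →
          ∃ (f : Equiv.Perm (ToralPH.Torus 4))
            (Ess Ec Euu : ToralPH.Torus 4 → Submodule ℝ (ToralPH.E 4)),
            ToralPH.MemPH A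
              (Module.End.eigenspace (ToralPH.linMap A) lss)
              (Module.End.eigenspace (ToralPH.linMap A) l ⊔
                Module.End.eigenspace (ToralPH.linMap A) m)
              (Module.End.eigenspace (ToralPH.linMap A) muu) f Ess Ec Euu ∧
            (∀ x, Module.finrank ℝ (Ec x) = 2) ∧
            (∀ x, x ∉ ToralPH.proj '' Metric.ball (0 : ToralPH.E 4) ε →
              f x = ToralPH.toralAut A x) ∧
            ToralPH.IsExpansive f ∧
            f 0 = 0 ∧ ∀ v ∈ Ec 0, ToralPH.torusDeriv f 0 v = v) := by
  constructor
  · intro n k A Sss Sc Suu lam b hA hPH _ hlam hb ε hε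
    obtain ⟨f, Ess, Euu, h⟩ := ToralPH.exists_perturbation_of_isSymm b hA hPH hlam hb hε
    exact ⟨f, Ess, _, Euu, h⟩
  · intro A lss l m muu h0 h1 h2 h3 h4 hss hl hm huu ε hε
    obtain ⟨hdim, f, Ess, Euu, hPH, h⟩ :=
      ToralPH.exists_perturbation_of_eigenvalues h0 h1 h2 h3 h4 hss hl hm huu hε
    exact ⟨f, Ess, _, Euu, hPH, fun _ => hdim, h⟩
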